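/- Let $l\ge-\frac12$. For $z\in\mathbb C$ and $x>0$ let $$\phi_l(z,x)=z^{-\frac{2l+1}{4}}\sqrt{\tfrac{\pi x}{2}}\,J_{l+\frac12}(\sqrt z\,x),$$ $$\theta_l(z,x)=-z^{\frac{2l+1}{4}}\sqrt{\tfrac{\pi x}{2}}\begin{cases}\frac{-1}{\sin((l+\frac12)\pi)}J_{-l-\frac12}(\sqrt z\,x), & l+\frac12\notin\mathbb N_0,\\ Y_{l+\frac12}(\sqrt z\,x)-\frac1\pi\log(z)\,J_{l+\frac12}(\sqrt z\,x), & l+\frac12\in\mathbb N_0,\end{cases}$$ where $J$ and $Y$ are the Bessel and Neumann functions and all branches are principal. These are two solutions of $-f''+\frac{l(l+1)}{x^2}f=zf$, both entire in $z$ (at $z=0$ they are given by their limits). Let $$G_l(z,x,y)=\phi_l(z,x)\theta_l(z,y)-\phi_l(z,y)\theta_l(z,x).$$ (i) For every $l\ge-\frac12$ there is a constant $C=C(l)>0$ such that for all $z\in\mathbb C$ and $0<x<1$ $$\left|\frac{\partial}{\partial x}\phi_l(z,x)\right|\le C\left(\frac{x}{1+|z|^{1/2}x}\right)^{l}e^{|\mathrm{Im}(z^{1/2})|x}.$$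 (ii) For every $l>-\frac12$ there is a constant $C=C(l)>0$ such that for all $z\in\mathbb C$ and $0<y\le x<1$ $$\left|\frac{\partial}{\partial x}G_l(z,x,y)\right|\le C\left(\frac{x}{1+|z|^{1/2}x}\right)^{l}\left(\frac{1+|z|^{1/2}y}{y}\right)^{l}e^{|\mathrm{Im}(z^{1/2})|(x-y)}.$$ (iii) For $l=-\frac12$ there is a constant $C>0$ such that for all $z\in\mathbb C$ and $0<y\le x<1$ $$\left|\frac{\partial}{\partial x}G_{-1/2}(z,x,y)\right|\le C\left(\frac{y+|z|^{1/2}xy}{x+|z|^{1/2}xy}\right)^{1/2}e^{|\mathrm{Im}(z^{1/2})|(x-y)}\,(1-\log y).$$ In each case the derivative in question exists. -/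

import Mathlib

open scoped Nat

noncomputable section

namespace SphericalSchrodinger

/-- The Bessel function `J_ν(w)` of real order `ν` (principal branch of the power), `w ≠ 0`:
`J_ν(w) = (w/2)^ν ∑_k (-1)^k (w/2)^(2k) / (k! Γ(ν+k+1))`.
At a pole of `Γ` Mathlib has `Γ = 0`, so the corresponding coefficient is `0`, as it should be. -/
def besselJ (ν : ℝ) (w : ℂ) : ℂ :=
  (w / 2) ^ (ν : ℂ) *
    ∑' k : ℕ, (-1 : ℂ) ^ k / ((k ! : ℂ) * (Real.Gamma (ν + k + 1) : ℂ)) * (w / 2) ^ (2 * k)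

/-- The Neumann function (Bessel function of the second kind) `Y_n(w)` of integer order `n ≥ 0`
(principal branch of the logarithm), `w ≠ 0`:
`Y_n(w) = -(1/π) (w/2)^(-n) ∑_{k<n} (n-k-1)!/k! (w/2)^(2k) + (2/π) log(w/2) J_n(w)
  - (1/π) (w/2)^n ∑_k (ψ(k+1) + ψ(n+k+1)) (-1)^k (w/2)^(2k) / (k! (n+k)!)`,
where `ψ(m+1) = H_m - γ` with the harmonic numbers `H_m`. In the first sum `k < n`, so that the
subtraction of natural numbers there is the true one. -/
def besselY (n : ℕ) (w : ℂ) : ℂ :=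
  -(1 / (Real.pi : ℂ)) * ((w / 2) ^ n)⁻¹ *
      (∑ k ∈ Finset.range n, ((n - k - 1)! : ℂ) / (k ! : ℂ) * (w / 2) ^ (2 * k))
    + 2 / (Real.pi : ℂ) * Complex.log (w / 2) * besselJ n w
    - 1 / (Real.pi : ℂ) * (w / 2) ^ n *
      ∑' k : ℕ, ((harmonic k : ℂ) + (harmonic (n + k) : ℂ)
          - 2 * (Real.eulerMascheroniConstant : ℂ)) *
        (-1 : ℂ) ^ k / ((k ! : ℂ) * ((n + k)! : ℂ)) * (w / 2) ^ (2 * k)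

/-- The solution `φ_l(z,x) = z^(-(2l+1)/4) √(πx/2) J_{l+1/2}(√z x)` of
`-f'' + l(l+1)/x² f = z f`, with principal branches. It is entire in `z`; the first line
is the value of the entire function at the removable singularity `z = 0`. -/
def phi (l : ℝ) (z : ℂ) (x : ℝ) : ℂ :=
  if z = 0 then
    ((Real.sqrt Real.pi / (Real.Gamma (l + 3 / 2) * 2 ^ (l + 1)) * x ^ (l + 1) : ℝ) : ℂ)
  else
    z ^ (-(2 * (l : ℂ) + 1) / 4) * (Real.sqrt (Real.pi * x / 2) : ℂ) *
      besselJ (l + 1 / 2) (z ^ (1 / 2 : ℂ) * x)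

/-- The second solution: `θ_l(z,x) = -z^((2l+1)/4) √(πx/2) B(z,x)`, where for `l + 1/2 ∈ ℕ₀`
`B = Y_{l+1/2}(√z x) - (1/π) log(z) J_{l+1/2}(√z x)`, and otherwise
`B = (-1/sin((l+1/2)π)) J_{-l-1/2}(√z x)`, with principal branches. It is entire in `z`;
the first two lines are the value of the entire function at the removable
singularity `z = 0`. -/
def theta (l : ℝ) (z : ℂ) (x : ℝ) : ℂ :=
  if z = 0 then
    if l = -1 / 2 then
      ((Real.sqrt (2 * x / Real.pi) *
        (Real.log 2 - Real.eulerMascheroniConstant - Real.log x) : ℝ) : ℂ)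
    else
      ((Real.Gamma (l + 3 / 2) * 2 ^ (l + 1) / ((2 * l + 1) * Real.sqrt Real.pi) *
        x ^ (-l) : ℝ) : ℂ)
  else
    -z ^ ((2 * (l : ℂ) + 1) / 4) * (Real.sqrt (Real.pi * x / 2) : ℂ) *
      if (⌊l + 1 / 2⌋₊ : ℝ) = l + 1 / 2 then
        besselY ⌊l + 1 / 2⌋₊ (z ^ (1 / 2 : ℂ) * x)
          - 1 / (Real.pi : ℂ) * Complex.log z * besselJ (l + 1 / 2) (z ^ (1 / 2 : ℂ) * x)
      else
        -1 / (Real.sin ((l + 1 / 2) * Real.pi) : ℂ) *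
          besselJ (-l - 1 / 2) (z ^ (1 / 2 : ℂ) * x)

/-- The Green function of the initial value problem:
`G_l(z,x,y) = φ_l(z,x) θ_l(z,y) - φ_l(z,y) θ_l(z,x)`. -/
def green (l : ℝ) (z : ℂ) (x y : ℝ) : ℂ :=
  phi l z x * theta l z y - phi l z y * theta l z x

end SphericalSchrodinger

end

/-! No Bessel asymptotics are needed. Up to real constants, `phi` and `theta` are Frobenius series
`t ^ α * ∑ c_j (z t² / 4) ^ j` with `α = l + 1` and `α = -l`, the latter with a logarithmic term
when `l + 1/2` is a natural number (`phi_eq_frob`, `exists_theta_eq_singularSol`). Write `s =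
|z|^(1/2)`. For `s t ≤ 1` the series are bounded termwise, which settles that region
(`exists_green_bound_near_zero`). In the Green function the logarithms combine to `log (x / y)`, and
their coefficient carries `(y / x) ^ (2 n)`. This absorbs the logarithm unless `n = 0`, that is `l =
-1/2`.

For `s t ≥ 1` the energy `|f'|² + |z| |f|²` of a solution of `f'' = (m / t² - z) f` has logarithmic
derivative at most `2 |Im √z| + |m| / (s t²)`, because `||z| - z| = 2 |Im √z| s`
(`energy_estimate`). The second summand integrates to at most `|m|` over `t ≥ 1/s`, so only the
desired exponential remains.

For fixed `y`, the Green function solves the equation in `x`. The energy estimate starts at `1/s` if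
`s y ≤ 1`. If `s y > 1` it starts at `y`, where the Green function vanishes and its derivative is
the constant Wronskian (`exists_green_bound`). -/

noncomputable section

namespace SphericalSchrodinger

/-! ### Entire power series -/

/-- The sum of the power series with coefficients `c`. -/
def powerSum (c : ℕ → ℂ) (u : ℂ) : ℂ := ∑' j, c j * u ^ j

/-- The power series with coefficients `c` converges absolutely on the whole plane. -/
def EntireCoeff (c : ℕ → ℂ) : Prop := ∀ r : ℝ, 0 ≤ r → Summable fun j => ‖c j‖ * r ^ j

namespace EntireCoeff

variable {c : ℕ → ℂ}

lemma summable (hc : EntireCoeff c) (u : ℂ) : Summable fun j => c j * u ^ j := by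
  refine Summable.of_norm ?_
  simpa using hc ‖u‖ (norm_nonneg u)

lemma norm_powerSum_le (hc : EntireCoeff c) {u : ℂ} (hu : ‖u‖ ≤ 1) :
    ‖powerSum c u‖ ≤ ∑' j, ‖c j‖ := by
  have h1 : Summable fun j => ‖c j‖ := by simpa using hc 1 zero_le_one
  refine tsum_of_norm_bounded h1.hasSum fun j => ?_
  rw [norm_mul, norm_pow]
  exact mul_le_of_le_one_right (norm_nonneg _) (pow_le_one₀ (norm_nonneg _) hu)

lemma affine_mul (hc : EntireCoeff c) (α β : ℂ) : EntireCoeff fun j => (α + β * j) * c j := by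
  intro r hr
  refine Summable.of_nonneg_of_le (fun j => by positivity) (fun j => ?_)
    ((hc (2 * r) (by positivity)).mul_left (‖α‖ + ‖β‖))
  have h2 : (j : ℝ) ≤ 2 ^ j := by exact_mod_cast (Nat.lt_two_pow_self (n := j)).le
  have h1 : (1 : ℝ) ≤ 2 ^ j := one_le_pow₀ (by norm_num)
  have : ‖α + β * j‖ ≤ (‖α‖ + ‖β‖) * 2 ^ j := by
    refine (norm_add_le _ _).trans ?_
    rw [norm_mul, Complex.norm_natCast, add_mul]
    exact add_le_add (le_mul_of_one_le_right (norm_nonneg _) h1)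
      (mul_le_mul_of_nonneg_left h2 (norm_nonneg _))
  calc ‖(α + β * j) * c j‖ * r ^ j = ‖α + β * j‖ * (‖c j‖ * r ^ j) := by rw [norm_mul]; ring
    _ ≤ ((‖α‖ + ‖β‖) * 2 ^ j) * (‖c j‖ * r ^ j) := by gcongr
    _ = _ := by rw [mul_pow]; ring

lemma powerSum_affine_mul (hc : EntireCoeff c) (α β u : ℂ) :
    powerSum (fun j => (α + β * j) * c j) u
      = α * powerSum c u + β * powerSum (fun j => j * c j) u := by
  have h1 := hc.summable u
  have h2 : Summable fun j : ℕ => ((j : ℂ) * c j) * u ^ j := by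
    simpa using (hc.affine_mul 0 1).summable u
  unfold powerSum
  rw [← tsum_mul_left, ← tsum_mul_left, ← (h1.mul_left α).tsum_add (h2.mul_left β)]
  exact tsum_congr fun j => by ring

/-- Only `u * d` is used later: the Euler operator acts diagonally on coefficients, so no index
shift appears. -/
lemma exists_hasDerivAt_powerSum (hc : EntireCoeff c) (u : ℂ) :
    ∃ d : ℂ, HasDerivAt (powerSum c) d u ∧ u * d = powerSum (fun j => j * c j) u := by
  refine ⟨∑' j, c j * (j * u ^ (j - 1)), ?_, ?_⟩
  -- The ball must contain `u`, and `R ≥ 1` lets `R ^ (j - 1)` be replaced by `R ^ j`, including at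
  -- `j = 0`.
  · set R : ℝ := ‖u‖ + 1 with hR
    have hR1 : 1 ≤ R := by rw [hR]; linarith [norm_nonneg u]
    have hs : Summable fun j : ℕ => ‖(j : ℂ) * c j‖ * R ^ j := by
      simpa using (hc.affine_mul 0 1) R (by positivity)
    refine hasDerivAt_tsum_of_isPreconnected (t := Metric.ball (0 : ℂ) R) (y₀ := u) hs
      Metric.isOpen_ball (convex_ball _ _).isPreconnected
      (fun j y _ => (hasDerivAt_pow j y).const_mul (c j)) (fun j y hy => ?_) ?_ (hc.summable u) ?_
    · have hy' : ‖y‖ ≤ R := by simpa using (mem_ball_zero_iff.1 hy).le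
      rw [norm_mul, norm_mul, norm_mul, norm_pow]
      calc ‖c j‖ * (‖(j : ℂ)‖ * ‖y‖ ^ (j - 1)) ≤ ‖c j‖ * (‖(j : ℂ)‖ * R ^ j) := by
            gcongr
            exact (pow_le_pow_left₀ (norm_nonneg _) hy' _).trans
              (pow_le_pow_right₀ hR1 (Nat.sub_le _ _))
        _ = _ := by ring
    · simp [hR]
    · simp [hR]
  · unfold powerSum
    rw [← tsum_mul_left]
    refine tsum_congr fun j => ?_
    rcases j with _ | j
    · simp
    · simp only [Nat.add_sub_cancel]; ring

/-- The ratio test in multiplied form, so that coefficients may vanish and `a` may be negative at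
first. -/
lemma of_ratio {c : ℕ → ℂ} (a : ℕ → ℝ) (ha : Filter.Tendsto a Filter.atTop Filter.atTop)
    (h : ∀ k, a k * ‖c (k + 1)‖ ≤ ‖c k‖) : EntireCoeff c := by
  intro r hr
  refine summable_of_ratio_norm_eventually_le (r := 1 / 2) (by norm_num) ?_
  filter_upwards [ha.eventually_ge_atTop (2 * (r + 1))] with k hk
  have h1 : 2 * (r + 1) * ‖c (k + 1)‖ ≤ ‖c k‖ :=
    (mul_le_mul_of_nonneg_right hk (norm_nonneg _)).trans (h k)
  rw [Real.norm_of_nonneg (by positivity), Real.norm_of_nonneg (by positivity), pow_succ]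
  have h2 : r * ‖c (k + 1)‖ ≤ 1 / 2 * ‖c k‖ := by nlinarith [norm_nonneg (c (k + 1))]
  calc ‖c (k + 1)‖ * (r ^ k * r) = (r * ‖c (k + 1)‖) * r ^ k := by ring
    _ ≤ (1 / 2 * ‖c k‖) * r ^ k := by gcongr
    _ = _ := by ring

end EntireCoeff

/-! ### Frobenius functions -/

/-- The Frobenius type function `t ^ α * ∑ c_j (z t² / 4) ^ j`. -/
def frob (α : ℝ) (c : ℕ → ℂ) (z : ℂ) (t : ℝ) : ℂ :=
  ((t ^ α : ℝ) : ℂ) * powerSum c (z * ((t : ℂ) / 2) ^ 2)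

/-- The coefficients of the derivative of `frob α c z`. -/
def frobDeriv (α : ℝ) (c : ℕ → ℂ) : ℕ → ℂ := fun j => ((α : ℂ) + 2 * j) * c j

lemma EntireCoeff.frobDeriv {c : ℕ → ℂ} (hc : EntireCoeff c) (α : ℝ) :
    EntireCoeff (frobDeriv α c) := hc.affine_mul _ _

/-- The operator `t d/dt` multiplies `t ^ α * u ^ j`, `u = z t² / 4`, by `α + 2 j`, so the class is
closed under differentiation. -/
lemma hasDerivAt_frob {c : ℕ → ℂ} (hc : EntireCoeff c) (α : ℝ) (z : ℂ) {t : ℝ} (ht : 0 < t) :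
    HasDerivAt (frob α c z) (frob (α - 1) (frobDeriv α c) z t) t := by
  obtain ⟨d, hd, hud⟩ := hc.exists_hasDerivAt_powerSum (z * ((t : ℂ) / 2) ^ 2)
  have h1 : HasDerivAt (fun t : ℝ => ((t ^ α : ℝ) : ℂ)) ((α * t ^ (α - 1) : ℝ) : ℂ) t :=
    (Real.hasDerivAt_rpow_const (Or.inl ht.ne')).ofReal_comp
  have h2 : HasDerivAt (fun t : ℝ => z * ((t : ℂ) / 2) ^ 2) (z * (t / 2)) t := by
    have := (((hasDerivAt_id t).ofReal_comp.div_const 2).pow 2).const_mul z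
    refine this.congr_deriv ?_
    push_cast [id]
    ring
  have h3 := h1.mul (hd.comp_of_eq t h2 rfl |>.congr_deriv rfl)
  refine h3.congr_deriv ?_
  have h4 : t ^ α = t ^ (α - 1) * t := by
    rw [← Real.rpow_add_one ht.ne']; congr 1; ring
  unfold frob SphericalSchrodinger.frobDeriv
  rw [hc.powerSum_affine_mul, ← hud, h4]
  simp only [Function.comp]
  push_cast
  ring

lemma norm_frob_le {c : ℕ → ℂ} (hc : EntireCoeff c) (α : ℝ) {z : ℂ} {t : ℝ} (ht : 0 < t)
    (hz : Real.sqrt ‖z‖ * t ≤ 1) : ‖frob α c z t‖ ≤ (∑' j, ‖c j‖) * t ^ α := by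
  have h0 : 0 ≤ Real.sqrt ‖z‖ * t := by positivity
  have h1 : ‖z * ((t : ℂ) / 2) ^ 2‖ ≤ 1 := by
    rw [norm_mul, norm_pow, norm_div, Complex.norm_real, Real.norm_of_nonneg ht.le,
      ← Real.sq_sqrt (norm_nonneg z), Complex.norm_ofNat]
    nlinarith
  unfold frob
  rw [norm_mul, Complex.norm_real, Real.norm_of_nonneg (Real.rpow_nonneg ht.le _), mul_comm]
  exact mul_le_mul_of_nonneg_right (hc.norm_powerSum_le h1) (Real.rpow_nonneg ht.le _)

/-! ### Energy estimate away from the singularity -/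

/-- The energy estimate for `f'' = (m / t² - z) f` away from the singularity. -/
lemma energy_estimate {m a x : ℝ} {z k : ℂ} (hk : k ^ 2 = z) (hz : z ≠ 0) (ha : 0 < a)
    (hax : a ≤ x) {f f' : ℝ → ℂ} (hf : ∀ t, 0 < t → HasDerivAt f (f' t) t)
    (hf' : ∀ t, 0 < t → HasDerivAt f' (((m / t ^ 2 : ℝ) - z) * f t) t) :
    ‖f' x‖ ^ 2 + ‖z‖ * ‖f x‖ ^ 2 ≤ (‖f' a‖ ^ 2 + ‖z‖ * ‖f a‖ ^ 2) *
      Real.exp (2 * |k.im| * (x - a) + |m| / (Real.sqrt ‖z‖ * a)) := by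
  set s := Real.sqrt ‖z‖ with hs
  have hs2 : s ^ 2 = ‖z‖ := Real.sq_sqrt (norm_nonneg z)
  have hs0 : 0 < s := Real.sqrt_pos.2 (norm_pos_iff.2 hz)
  have hks : ‖k‖ = s := by
    rw [hs, ← hk, norm_pow, Real.sqrt_sq (norm_nonneg k)]
  set b := |k.im| with hb
  -- With `z = k²` and `|z| = k k̄`, the difference is `k (k̄ - k) = -2 i k Im k`.
  have hzz : ‖(‖z‖ : ℂ) - z‖ = 2 * b * s := by
    have h1 : (‖z‖ : ℂ) = k * (starRingEnd ℂ) k := by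
      rw [Complex.mul_conj, ← hk, norm_pow, Complex.normSq_eq_norm_sq]
    have h2 : (‖z‖ : ℂ) - z = k * (-(2 * k.im : ℝ) * Complex.I) := by
      have := Complex.sub_conj k
      rw [h1, ← hk]
      linear_combination (-k) * this
    rw [h2, norm_mul, norm_mul, norm_neg, Complex.norm_real, Complex.norm_I, hks, Real.norm_eq_abs,
      abs_mul, hb]
    norm_num
    ring
  set M : ℝ → ℝ := fun t => ‖f' t‖ ^ 2 + ‖z‖ * ‖f t‖ ^ 2 with hM
  -- The exponent is an antiderivative of `-(2 b + |m| / (s t²))`, so the Gronwall inequality for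
  -- `M` becomes monotonicity of `N`.
  set N : ℝ → ℝ := fun t => M t * Real.exp (-(2 * b * t) + |m| / s * t⁻¹) with hN
  have hMd : ∀ t, 0 < t → HasDerivAt M (2 * inner ℝ (f' t) (((m / t ^ 2 : ℝ) - z) * f t)
      + ‖z‖ * (2 * inner ℝ (f t) (f' t))) t := fun t ht =>
    (hf' t ht).norm_sq.add ((hf t ht).norm_sq.const_mul _)
  have hNd : ∀ t, 0 < t → HasDerivAt N (
      (2 * inner ℝ (f' t) (((m / t ^ 2 : ℝ) - z) * f t) + ‖z‖ * (2 * inner ℝ (f t) (f' t))) *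
        Real.exp (-(2 * b * t) + |m| / s * t⁻¹) +
      M t * (Real.exp (-(2 * b * t) + |m| / s * t⁻¹) *
        (-(2 * b * 1) + |m| / s * (-(t ^ 2)⁻¹)))) t := fun t ht =>
    (hMd t ht).mul ((((hasDerivAt_id t).const_mul (2 * b)).neg.add
      ((hasDerivAt_inv ht.ne').const_mul (|m| / s))).exp)
  have hanti : AntitoneOn N (Set.Icc a x) := by
    refine antitoneOn_of_deriv_nonpos (convex_Icc a x)
      (fun t ht => (hNd t (ha.trans_le ht.1)).continuousAt.continuousWithinAt)
      (fun t ht => ?_) (fun t ht => ?_)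
    · rw [interior_Icc] at ht
      exact (hNd t (ha.trans ht.1)).differentiableAt.differentiableWithinAt
    · rw [interior_Icc] at ht
      have ht0 : 0 < t := ha.trans ht.1
      rw [(hNd t ht0).deriv]
      have key : 2 * inner ℝ (f' t) (((m / t ^ 2 : ℝ) - z) * f t)
          + ‖z‖ * (2 * inner ℝ (f t) (f' t)) ≤ (2 * b + |m| / s * (t ^ 2)⁻¹) * M t := by
        have e1 : inner ℝ (f' t) (((m / t ^ 2 : ℝ) - z) * f t) + ‖z‖ * inner ℝ (f t) (f' t)
            = inner ℝ (f' t) (((m / t ^ 2 : ℝ) : ℂ) * f t)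
              + inner ℝ (f' t) (((‖z‖ : ℂ) - z) * f t) := by
          simp only [Complex.inner, Complex.mul_re, Complex.mul_im, Complex.sub_re, Complex.sub_im,
            Complex.conj_re, Complex.conj_im, Complex.ofReal_re, Complex.ofReal_im]
          ring
        have e2 : inner ℝ (f' t) (((m / t ^ 2 : ℝ) : ℂ) * f t)
            ≤ ‖f' t‖ * (|m| * (t ^ 2)⁻¹ * ‖f t‖) := by
          refine (real_inner_le_norm _ _).trans (le_of_eq ?_)
          rw [norm_mul, Complex.norm_real, Real.norm_eq_abs, abs_div, abs_of_pos (pow_pos ht0 2)]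
          ring
        have e3 : inner ℝ (f' t) (((‖z‖ : ℂ) - z) * f t) ≤ ‖f' t‖ * (2 * b * s * ‖f t‖) := by
          refine (real_inner_le_norm _ _).trans (le_of_eq ?_)
          rw [norm_mul, hzz]
        have e4 : 2 * s * (‖f t‖ * ‖f' t‖) ≤ M t := by
          simp only [hM]; rw [← hs2]; nlinarith [sq_nonneg (‖f' t‖ - s * ‖f t‖)]
        have e5 : 0 ≤ 2 * b + |m| / s * (t ^ 2)⁻¹ := by positivity
        have e6 := mul_le_mul_of_nonneg_left e4 e5
        have e7 : (2 * b + |m| / s * (t ^ 2)⁻¹) * (2 * s * (‖f t‖ * ‖f' t‖))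
            = 2 * (‖f' t‖ * (|m| * (t ^ 2)⁻¹ * ‖f t‖)) + 2 * (‖f' t‖ * (2 * b * s * ‖f t‖)) := by
          field_simp
          ring
        linarith
      have he := Real.exp_pos (-(2 * b * t) + |m| / s * t⁻¹)
      nlinarith
  have hfin := hanti (Set.left_mem_Icc.2 hax) (Set.right_mem_Icc.2 hax) hax
  have hx0 : 0 < x := ha.trans_le hax
  simp only [hN] at hfin
  have hMa : 0 ≤ M a := by positivity
  have hMx : 0 ≤ M x := by positivity
  change M x ≤ M a * _
  have h1 : M x * Real.exp (-(2 * b * x)) ≤ M x * Real.exp (-(2 * b * x) + |m| / s * x⁻¹) := by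
    gcongr
    have : 0 ≤ |m| / s * x⁻¹ := by positivity
    linarith
  have h2 := h1.trans hfin
  have h3 := mul_le_mul_of_nonneg_right h2 (Real.exp_pos (2 * b * x)).le
  rw [mul_assoc (M x), mul_assoc (M a), ← Real.exp_add, ← Real.exp_add] at h3
  rw [neg_add_cancel, Real.exp_zero, mul_one] at h3
  refine h3.trans_eq ?_
  congr 2
  field_simp
  ring

/-- Starting where `s a ≥ 1` makes the contribution of `m / t²` at most `exp |m|`, uniformly in `z`.
-/
lemma norm_deriv_le_of_energy {m a x D : ℝ} {z : ℂ} (hz : z ≠ 0) (ha : 0 < a)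
    (hsa : 1 ≤ Real.sqrt ‖z‖ * a) (hax : a ≤ x) {f f' : ℝ → ℂ}
    (hf : ∀ t, 0 < t → HasDerivAt f (f' t) t)
    (hf' : ∀ t, 0 < t → HasDerivAt f' (((m / t ^ 2 : ℝ) - z) * f t) t)
    (hD' : ‖f' a‖ ≤ D) (hD : Real.sqrt ‖z‖ * ‖f a‖ ≤ D) :
    ‖f' x‖ ≤ 2 * Real.exp |m| * D * Real.exp (|(z ^ (1 / 2 : ℂ)).im| * (x - a)) := by
  have hk : (z ^ (1 / 2 : ℂ)) ^ 2 = z := by simp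
  have h := energy_estimate hk hz ha hax hf hf'
  set b := |(z ^ (1 / 2 : ℂ)).im|
  set s := Real.sqrt ‖z‖ with hs
  have hs2 : s ^ 2 = ‖z‖ := Real.sq_sqrt (norm_nonneg z)
  have hD0 : 0 ≤ D := (norm_nonneg _).trans hD'
  have h1 : ‖f' a‖ ^ 2 + ‖z‖ * ‖f a‖ ^ 2 ≤ 2 * D ^ 2 := by
    have e1 : ‖f' a‖ ^ 2 ≤ D ^ 2 := pow_le_pow_left₀ (norm_nonneg _) hD' 2
    have e2 : (s * ‖f a‖) ^ 2 ≤ D ^ 2 := pow_le_pow_left₀ (by positivity) hD 2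
    rw [mul_pow, hs2] at e2
    linarith
  have h2 : |m| / (s * a) ≤ |m| := div_le_self (abs_nonneg m) hsa
  -- The constant is generous: `2 exp |m| ≤ (2 exp |m|)²` avoids square roots.
  have h3 : ‖f' x‖ ^ 2 ≤ (2 * Real.exp |m| * D * Real.exp (b * (x - a))) ^ 2 := by
    have e0 : 0 ≤ ‖z‖ * ‖f x‖ ^ 2 := by positivity
    have e1 : 1 ≤ Real.exp |m| := Real.one_le_exp (abs_nonneg m)
    calc ‖f' x‖ ^ 2 ≤ ‖f' x‖ ^ 2 + ‖z‖ * ‖f x‖ ^ 2 := by linarith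
      _ ≤ _ := h
      _ ≤ 2 * D ^ 2 * Real.exp (2 * b * (x - a) + |m|) := by gcongr
      _ = 2 * Real.exp |m| * (D * Real.exp (b * (x - a))) ^ 2 := by
          rw [Real.exp_add, show 2 * b * (x - a) = b * (x - a) + b * (x - a) by ring, Real.exp_add]
          ring
      _ ≤ (2 * Real.exp |m|) ^ 2 * (D * Real.exp (b * (x - a))) ^ 2 := by
          gcongr
          nlinarith
      _ = _ := by ring
  exact le_of_abs_le (by simpa using abs_le_of_sq_le_sq h3 (by positivity))

/-! ### Bounds near the singularity extended to all arguments -/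

lemma rpow_le_of_comparable {r r' l : ℝ} (hr : 0 < r) (hr' : 0 < r') (h1 : r' ≤ 2 * r)
    (h2 : r ≤ 2 * r') : r ^ l ≤ 2 ^ |l| * r' ^ l := by
  rcases le_total 0 l with hl | hl
  · rw [abs_of_nonneg hl, ← Real.mul_rpow two_pos.le hr'.le]
    exact Real.rpow_le_rpow hr.le h2 hl
  · have : r ^ l ≤ (r' / 2) ^ l := Real.rpow_le_rpow_of_nonpos (by positivity) (by linarith) hl
    rwa [Real.div_rpow hr'.le two_pos.le, div_eq_mul_inv, ← Real.rpow_neg two_pos.le,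
      ← abs_of_nonpos hl, mul_comm] at this

/-- Bound for the derivative of a regular solution. -/
theorem exists_regular_bound {l m C : ℝ} {f f' : ℂ → ℝ → ℂ}
    (hf : ∀ z t, 0 < t → HasDerivAt (f z) (f' z t) t)
    (hf' : ∀ z t, 0 < t → HasDerivAt (f' z) (((m / t ^ 2 : ℝ) - z) * f z t) t)
    (hC : 0 < C)
    (hs' : ∀ z t, 0 < t → Real.sqrt ‖z‖ * t ≤ 1 → ‖f' z t‖ ≤ C * t ^ l)
    (hs : ∀ z t, 0 < t → Real.sqrt ‖z‖ * t ≤ 1 → ‖f z t‖ ≤ C * t ^ (l + 1)) :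
    ∃ C' : ℝ, 0 < C' ∧ ∀ (z : ℂ) (x : ℝ), 0 < x → ‖f' z x‖ ≤
      C' * (x / (1 + Real.sqrt ‖z‖ * x)) ^ l * Real.exp (|(z ^ (1 / 2 : ℂ)).im| * x) := by
  refine ⟨2 * Real.exp |m| * C * 2 ^ |l|, by positivity, fun z x hx => ?_⟩
  set b := |(z ^ (1 / 2 : ℂ)).im| with hb
  have hb0 : 0 ≤ b := abs_nonneg _
  have hm : 1 ≤ Real.exp |m| := Real.one_le_exp (abs_nonneg m)
  set s := Real.sqrt ‖z‖ with hsd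
  have hs0 : 0 ≤ s := Real.sqrt_nonneg _
  have hsx0 : 0 ≤ s * x := by positivity
  rcases le_or_gt (s * x) 1 with hsx | hsx
  · have h1 : x ^ l ≤ 2 ^ |l| * (x / (1 + s * x)) ^ l := by
      refine rpow_le_of_comparable hx (by positivity) ?_ ?_
      · rw [div_le_iff₀ (by positivity)]; nlinarith
      · rw [← mul_div_assoc, le_div_iff₀ (by positivity)]; nlinarith
    have h2 : 1 ≤ Real.exp (b * x) := Real.one_le_exp (by positivity)
    calc ‖f' z x‖ ≤ C * x ^ l := hs' z x hx hsx
      _ ≤ C * (2 ^ |l| * (x / (1 + s * x)) ^ l) := by gcongr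
      _ = 1 * (C * (2 ^ |l| * (x / (1 + s * x)) ^ l)) * 1 := by ring
      _ ≤ (2 * Real.exp |m|) * (C * (2 ^ |l| * (x / (1 + s * x)) ^ l)) * Real.exp (b * x) := by
          gcongr
          linarith
      _ = _ := by ring
  · have hspos : 0 < s := by
      rcases hs0.eq_or_lt with h | h
      · rw [← h] at hsx; norm_num at hsx
      · exact h
    have hz : z ≠ 0 := by rintro rfl; simp [hsd] at hspos
    have ha : 0 < s⁻¹ := inv_pos.2 hspos
    have hsa : s * s⁻¹ = 1 := mul_inv_cancel₀ hspos.ne'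
    have hax : s⁻¹ ≤ x := by
      rw [inv_le_iff_one_le_mul₀ hspos]; linarith
    -- Since `s x > 1`, the quantity `x / (1 + s x)` lies between `1 / (2 s)` and `1 / s`; hence the
    -- starting point `1 / s` has the right size.
    have h1 : s⁻¹ ^ l ≤ 2 ^ |l| * (x / (1 + s * x)) ^ l := by
      refine rpow_le_of_comparable ha (by positivity) ?_ ?_
      · rw [div_le_iff₀ (by positivity)]
        have : 2 * s⁻¹ * (1 + s * x) = 2 * s⁻¹ + 2 * x * (s * s⁻¹) := by ring
        rw [this, hsa]; linarith
      · rw [← mul_div_assoc, le_div_iff₀ (by positivity)]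
        have : s⁻¹ * (1 + s * x) = s⁻¹ + x * (s * s⁻¹) := by ring
        rw [this, hsa]; linarith
    have h2 := norm_deriv_le_of_energy (D := C * s⁻¹ ^ l) hz ha hsa.ge hax (hf z) (hf' z)
      (hs' z _ ha hsa.le) (by
        have := hs z _ ha hsa.le
        rw [Real.rpow_add_one ha.ne'] at this
        calc s * ‖f z s⁻¹‖ ≤ s * (C * (s⁻¹ ^ l * s⁻¹)) := by gcongr
          _ = (s * s⁻¹) * (C * s⁻¹ ^ l) := by ring
          _ = _ := by rw [hsa, one_mul])
    calc ‖f' z x‖ ≤ _ := h2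
      _ ≤ 2 * Real.exp |m| * (C * (2 ^ |l| * (x / (1 + s * x)) ^ l)) * Real.exp (b * x) := by
          gcongr
          linarith
      _ = _ := by ring

/-- The equation has no first-order term, so the derivative of the Wronskian vanishes. -/
lemma wronskian_const {m a y : ℝ} {z : ℂ} {f f' g g' : ℝ → ℂ} (ha : 0 < a) (hay : a ≤ y)
    (hf : ∀ t, 0 < t → HasDerivAt f (f' t) t)
    (hf' : ∀ t, 0 < t → HasDerivAt f' (((m / t ^ 2 : ℝ) - z) * f t) t)
    (hg : ∀ t, 0 < t → HasDerivAt g (g' t) t)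
    (hg' : ∀ t, 0 < t → HasDerivAt g' (((m / t ^ 2 : ℝ) - z) * g t) t) :
    f' y * g y - f y * g' y = f' a * g a - f a * g' a := by
  have hW : ∀ t, 0 < t → HasDerivAt (fun t => f' t * g t - f t * g' t) 0 t := fun t ht =>
    (((hf' t ht).mul (hg t ht)).sub ((hf t ht).mul (hg' t ht))).congr_deriv (by ring)
  exact constant_of_has_deriv_right_zero
    (fun t ht => (hW t (ha.trans_le ht.1)).continuousAt.continuousWithinAt)
    (fun t ht => (hW t (ha.trans_le ht.1)).hasDerivWithinAt) y (Set.right_mem_Icc.2 hay)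

/-- Bound for the derivative of the Green function of two solutions, from the corresponding bounds
near the singularity. -/
theorem exists_green_bound {l m C ε : ℝ} (hε : 0 ≤ ε) {f f' g g' : ℂ → ℝ → ℂ}
    (hf : ∀ z t, 0 < t → HasDerivAt (f z) (f' z t) t)
    (hf' : ∀ z t, 0 < t → HasDerivAt (f' z) (((m / t ^ 2 : ℝ) - z) * f z t) t)
    (hg : ∀ z t, 0 < t → HasDerivAt (g z) (g' z t) t)
    (hg' : ∀ z t, 0 < t → HasDerivAt (g' z) (((m / t ^ 2 : ℝ) - z) * g z t) t)
    (hC : 0 < C)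
    (hs' : ∀ z x y, 0 < y → y ≤ x → Real.sqrt ‖z‖ * x ≤ 1 →
      ‖f' z x * g z y - f z y * g' z x‖ ≤ C * (x / y) ^ l * (1 + ε * Real.log (x / y)))
    (hs : ∀ z x y, 0 < y → y ≤ x → Real.sqrt ‖z‖ * x ≤ 1 →
      ‖f z x * g z y - f z y * g z x‖ ≤ C * x * (x / y) ^ l * (1 + ε * Real.log (x / y))) :
    ∃ C' : ℝ, 0 < C' ∧ ∀ (z : ℂ) (x y : ℝ), 0 < y → y ≤ x → x < 1 →
      ‖f' z x * g z y - f z y * g' z x‖ ≤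
      C' * (x / (1 + Real.sqrt ‖z‖ * x)) ^ l * ((1 + Real.sqrt ‖z‖ * y) / y) ^ l *
        Real.exp (|(z ^ (1 / 2 : ℂ)).im| * (x - y)) * (1 - ε * Real.log y) := by
  refine ⟨2 * Real.exp |m| * C * 2 ^ |l|, by positivity, fun z x y hy hyx hx1 => ?_⟩
  have hx : 0 < x := hy.trans_le hyx
  set b := |(z ^ (1 / 2 : ℂ)).im| with hb
  have hb0 : 0 ≤ b := abs_nonneg _
  have hm : 1 ≤ Real.exp |m| := Real.one_le_exp (abs_nonneg m)
  set s := Real.sqrt ‖z‖ with hsd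
  have hs0 : 0 ≤ s := Real.sqrt_nonneg _
  have hsx0 : 0 ≤ s * x := by positivity
  have hsy0 : 0 ≤ s * y := by positivity
  have hsyx : s * y ≤ s * x := by gcongr
  have hlogy : Real.log y ≤ 0 := Real.log_nonpos hy.le (hyx.trans hx1.le)
  have hεl : 0 ≤ -(ε * Real.log y) := by nlinarith
  -- Here `x < 1` enters: `log (t / y) ≤ -log y` for `t < 1`.
  have hwt : ∀ t, y ≤ t → t ≤ x → 1 + ε * Real.log (t / y) ≤ 1 - ε * Real.log y := by
    intro t hyt htx
    have ht : 0 < t := hy.trans_le hyt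
    rw [Real.log_div ht.ne' hy.ne']
    have : Real.log t ≤ 0 := Real.log_nonpos ht.le (htx.trans hx1.le)
    nlinarith
  -- The target weight is comparable to `x / y`, `1 / (s y)` or `1`, according to whether `s x ≤ 1`,
  -- `s y ≤ 1 < s x` or `1 < s y`.
  have hcmp : ∀ r, 0 < r → x / (1 + s * x) * ((1 + s * y) / y) ≤ 2 * r →
      r ≤ 2 * (x / (1 + s * x) * ((1 + s * y) / y)) →
      r ^ l ≤ 2 ^ |l| * ((x / (1 + s * x)) ^ l * ((1 + s * y) / y) ^ l) := by
    intro r hr h1 h2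
    rw [← Real.mul_rpow (by positivity) (by positivity)]
    exact rpow_le_of_comparable hr (by positivity) h1 h2
  set B := (x / (1 + s * x)) ^ l * ((1 + s * y) / y) ^ l with hB
  have hB0 : 0 < B := by positivity
  have hexp : 1 ≤ Real.exp (b * (x - y)) := Real.one_le_exp (mul_nonneg hb0 (by linarith))
  suffices h : ‖f' z x * g z y - f z y * g' z x‖ ≤
      2 * Real.exp |m| * (C * (2 ^ |l| * B) * (1 - ε * Real.log y)) * Real.exp (b * (x - y)) by
    refine h.trans_eq ?_
    rw [hB]
    ring
  have hnn : 0 ≤ 1 - ε * Real.log y := by linarith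
  -- With `y` frozen, the Green function is a combination of two solutions, so the energy estimate
  -- applies to it in `t`.
  have hG : ∀ t, 0 < t → HasDerivAt (fun t => f z t * g z y - f z y * g z t)
      (f' z t * g z y - f z y * g' z t) t := fun t ht =>
    ((hf z t ht).mul_const _).sub ((hg z t ht).const_mul _)
  have hG' : ∀ t, 0 < t → HasDerivAt (fun t => f' z t * g z y - f z y * g' z t)
      (((m / t ^ 2 : ℝ) - z) * (f z t * g z y - f z y * g z t)) t := fun t ht =>
    (((hf' z t ht).mul_const _).sub ((hg' z t ht).const_mul _)).congr_deriv (by ring)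
  rcases le_or_gt (s * x) 1 with hsx | hsx
  · have h1 : (x / y) ^ l ≤ 2 ^ |l| * B := by
      refine hcmp _ (by positivity) ?_ ?_
      · rw [div_mul_div_comm, ← mul_div_assoc, div_le_div_iff₀ (by positivity) (by positivity)]
        have : 0 ≤ x * y := by positivity
        nlinarith [mul_le_mul_of_nonneg_left hsyx this, mul_nonneg this hsx0]
      · rw [div_mul_div_comm, ← mul_div_assoc, div_le_div_iff₀ (by positivity) (by positivity)]
        have : 0 ≤ x * y := by positivity
        nlinarith [mul_le_mul_of_nonneg_left hsx this, mul_nonneg this hsy0]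
    calc ‖f' z x * g z y - f z y * g' z x‖
        ≤ C * (x / y) ^ l * (1 + ε * Real.log (x / y)) := hs' z x y hy hyx hsx
      _ ≤ C * (x / y) ^ l * (1 - ε * Real.log y) := by
          gcongr; exact hwt x hyx le_rfl
      _ ≤ C * (2 ^ |l| * B) * (1 - ε * Real.log y) := by gcongr
      _ = 1 * (C * (2 ^ |l| * B) * (1 - ε * Real.log y)) * 1 := by ring
      _ ≤ _ := by gcongr; linarith
  · have hspos : 0 < s := by
      rcases hs0.eq_or_lt with h | h
      · rw [← h] at hsx; norm_num at hsx
      · exact h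
    have hz : z ≠ 0 := by rintro rfl; simp [hsd] at hspos
    have ha : 0 < s⁻¹ := inv_pos.2 hspos
    have hsa : s * s⁻¹ = 1 := mul_inv_cancel₀ hspos.ne'
    have hax : s⁻¹ ≤ x := by
      rw [inv_le_iff_one_le_mul₀ hspos]; linarith
    rcases le_or_gt (s * y) 1 with hsy | hsy
    · have hya : y ≤ s⁻¹ := by
        rw [← mul_le_mul_iff_of_pos_left hspos, hsa]; exact hsy
      have h1 : (s⁻¹ / y) ^ l ≤ 2 ^ |l| * B := by
        refine hcmp _ (by positivity) ?_ ?_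
        · rw [div_mul_div_comm, ← mul_div_assoc, div_le_div_iff₀ (by positivity) (by positivity)]
          have e : 2 * s⁻¹ * ((1 + s * x) * y) = 2 * s⁻¹ * y + 2 * (s * s⁻¹) * (x * y) := by ring
          rw [e, hsa]
          have : 0 ≤ x * y := by positivity
          have : 0 ≤ s⁻¹ * y := by positivity
          nlinarith
        · rw [div_mul_div_comm, ← mul_div_assoc, div_le_div_iff₀ (by positivity) (by positivity)]
          have e : s⁻¹ * ((1 + s * x) * y) = s⁻¹ * y + (s * s⁻¹) * (x * y) := by ring
          rw [e, hsa]
          have h3 : 0 ≤ x * y := by positivity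
          nlinarith [mul_nonneg h3 hsy0, mul_le_mul_of_nonneg_right hax hy.le]
      have hD : C * (s⁻¹ / y) ^ l * (1 + ε * Real.log (s⁻¹ / y)) ≤
          C * (2 ^ |l| * B) * (1 - ε * Real.log y) := by
        calc _ ≤ C * (s⁻¹ / y) ^ l * (1 - ε * Real.log y) := by
              gcongr; exact hwt _ hya hax
          _ ≤ _ := by gcongr
      refine (norm_deriv_le_of_energy hz ha hsa.ge hax hG hG'
        ((hs' z _ y hy hya hsa.le).trans hD) ?_).trans ?_
      · refine le_trans ?_ hD
        calc s * ‖f z s⁻¹ * g z y - f z y * g z s⁻¹‖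
            ≤ s * (C * s⁻¹ * (s⁻¹ / y) ^ l * (1 + ε * Real.log (s⁻¹ / y))) := by
              gcongr; exact hs z _ y hy hya hsa.le
          _ = (s * s⁻¹) * (C * (s⁻¹ / y) ^ l * (1 + ε * Real.log (s⁻¹ / y))) := by ring
          _ = _ := by rw [hsa, one_mul]
      · gcongr
    · have hay : s⁻¹ ≤ y := by
        rw [inv_le_iff_one_le_mul₀ hspos]; linarith
      have h1 : (1 : ℝ) ^ l ≤ 2 ^ |l| * B := by
        refine hcmp _ one_pos ?_ ?_
        · rw [div_mul_div_comm, div_le_iff₀ (by positivity)]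
          have h3 : 0 ≤ x * y := by positivity
          nlinarith [mul_le_mul_of_nonneg_left hsy.le hx.le]
        · rw [div_mul_div_comm, ← mul_div_assoc, le_div_iff₀ (by positivity)]
          nlinarith [mul_nonneg hsx0 hy.le]
      rw [Real.one_rpow] at h1
      have hW := wronskian_const ha hay (hf z) (hf' z) (hg z) (hg' z)
      -- The Wronskian is evaluated at `1 / s`, where the small-argument bound with `x = y` gives
      -- exactly `C`.
      have hWb : ‖f' z y * g z y - f z y * g' z y‖ ≤ C := by
        rw [hW]
        simpa [div_self ha.ne'] using hs' z _ _ ha le_rfl hsa.le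
      have hD : C ≤ C * (2 ^ |l| * B) * (1 - ε * Real.log y) := by
        calc C = C * 1 * 1 := by ring
          _ ≤ _ := by gcongr; linarith
      refine norm_deriv_le_of_energy hz hy hsy.le hyx hG hG' (hWb.trans hD) ?_
      -- The Green function vanishes on the diagonal, so only its derivative contributes to the
      -- initial energy.
      rw [mul_comm (f z y), sub_self]
      simpa using hC.le.trans hD

/-! ### The singular solution and its logarithm -/

/-- The solution with the exponent `-l` at the singularity. -/
def singularSol (l κ : ℝ) (n : ℕ) (p q : ℕ → ℂ) (z : ℂ) (t : ℝ) : ℂ :=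
  frob (-l) q z t - 2 * κ * (z / 4) ^ n * (Real.log (t / 2) * frob (l + 1) p z t)

/-- The derivative of `singularSol`. -/
def singularSolDeriv (l κ : ℝ) (n : ℕ) (p q : ℕ → ℂ) (z : ℂ) (t : ℝ) : ℂ :=
  frob (-l - 1) (frobDeriv (-l) q) z t - 2 * κ * (z / 4) ^ n *
    ((t⁻¹ : ℝ) * frob (l + 1) p z t +
      Real.log (t / 2) * frob (l + 1 - 1) (frobDeriv (l + 1) p) z t)

lemma hasDerivAt_log_half {t : ℝ} (ht : 0 < t) :
    HasDerivAt (fun t : ℝ => (Real.log (t / 2) : ℂ)) (t⁻¹ : ℝ) t := by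
  have := (((hasDerivAt_id t).div_const 2).log (by simpa using ht.ne')).ofReal_comp
  refine this.congr_deriv ?_
  simp only [id]
  congr 1
  field_simp

lemma hasDerivAt_singularSol {l κ : ℝ} {n : ℕ} {p q : ℕ → ℂ} (hp : EntireCoeff p)
    (hq : EntireCoeff q) (z : ℂ) {t : ℝ} (ht : 0 < t) :
    HasDerivAt (singularSol l κ n p q z) (singularSolDeriv l κ n p q z t) t :=
  (hasDerivAt_frob hq (-l) z ht).sub
    (((hasDerivAt_log_half ht).mul (hasDerivAt_frob hp (l + 1) z ht)).const_mul _)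

/-- Multiplying the series identity in `u = z t² / 4` by `t ^ (α - 2)` gives the differential
equation, since `4 u / t² = z`; `R` is the source. -/
lemma frob_ode {c : ℕ → ℂ} {α m : ℝ} {R : ℂ → ℂ}
    (h : ∀ u, powerSum (frobDeriv (α - 1) (frobDeriv α c)) u =
      (m - 4 * u) * powerSum c u + R u) (z : ℂ) {t : ℝ} (ht : 0 < t) :
    frob (α - 1 - 1) (frobDeriv (α - 1) (frobDeriv α c)) z t =
      ((m / t ^ 2 : ℝ) - z) * frob α c z t
        + ((t ^ (α - 1 - 1) : ℝ) : ℂ) * R (z * ((t : ℂ) / 2) ^ 2) := by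
  have h4 : t ^ α = t ^ (α - 1 - 1) * t ^ 2 := by
    rw [← Real.rpow_natCast t 2, ← Real.rpow_add ht]; congr 1; push_cast; ring
  have ht' : (t : ℂ) ≠ 0 := by exact_mod_cast ht.ne'
  unfold frob
  rw [h, h4]
  push_cast
  field_simp
  ring

/-- Differentiating `log (t / 2) * P` twice leaves `2 P' / t - P / t²` besides the solution part.
Its series has coefficients `(2 l + 1 + 4 j) p_j`, and the source in `hqE` is chosen to cancel it.
-/
lemma hasDerivAt_singularSolDeriv {l κ : ℝ} {n : ℕ} {p q : ℕ → ℂ} (hp : EntireCoeff p)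
    (hq : EntireCoeff q) (hn : κ = 0 ∨ (n : ℝ) = l + 1 / 2)
    (hpE : ∀ u, powerSum (frobDeriv (l + 1 - 1) (frobDeriv (l + 1) p)) u =
      (((l * (l + 1) : ℝ) : ℂ) - 4 * u) * powerSum p u)
    (hqE : ∀ u, powerSum (frobDeriv (-l - 1) (frobDeriv (-l) q)) u =
      (((l * (l + 1) : ℝ) : ℂ) - 4 * u) * powerSum q u +
        2 * κ * u ^ n * powerSum (fun j => (2 * l + 1 + 4 * j) * p j) u)
    (z : ℂ) {t : ℝ} (ht : 0 < t) :
    HasDerivAt (singularSolDeriv l κ n p q z)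
      (((l * (l + 1) / t ^ 2 : ℝ) - z) * singularSol l κ n p q z t) t := by
  have hinv : HasDerivAt (fun t : ℝ => ((t⁻¹ : ℝ) : ℂ)) ((-(t ^ 2)⁻¹ : ℝ) : ℂ) t :=
    (hasDerivAt_inv ht.ne').ofReal_comp
  have hP := hasDerivAt_frob hp (l + 1) z ht
  have hP' := hasDerivAt_frob (hp.frobDeriv (l + 1)) (l + 1 - 1) z ht
  have h := (hasDerivAt_frob (hq.frobDeriv (-l)) (-l - 1) z ht).sub
    (((hinv.mul hP).add ((hasDerivAt_log_half ht).mul hP')).const_mul (2 * κ * (z / 4) ^ n))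
  refine h.congr_deriv ?_
  have hpE' : ∀ u, powerSum (frobDeriv (l + 1 - 1) (frobDeriv (l + 1) p)) u =
      (((l * (l + 1) : ℝ) : ℂ) - 4 * u) * powerSum p u + (fun _ => 0) u := by simpa using hpE
  rw [frob_ode hqE z ht, frob_ode hpE' z ht]
  have ht' : (t : ℂ) ≠ 0 := by exact_mod_cast ht.ne'
  have key : ((t ^ (-l - 1 - 1) : ℝ) : ℂ) * (2 * κ * (z * ((t : ℂ) / 2) ^ 2) ^ n *
        powerSum (fun j => (2 * l + 1 + 4 * j) * p j) (z * ((t : ℂ) / 2) ^ 2)) =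
      2 * κ * (z / 4) ^ n * (2 * (t⁻¹ : ℝ) * frob (l + 1 - 1) (frobDeriv (l + 1) p) z t
        - ((t ^ 2)⁻¹ : ℝ) * frob (l + 1) p z t) := by
    rcases hn with hn | hn
    · simp [hn]
    · have e1 : ∀ u, powerSum (fun j => (2 * l + 1 + 4 * j) * p j) u =
          2 * powerSum (frobDeriv (l + 1) p) u - powerSum p u := by
        intro u
        unfold frobDeriv
        rw [hp.powerSum_affine_mul, hp.powerSum_affine_mul]
        push_cast
        ring
      have e2 : t ^ (l + 1) = t ^ (-l - 1 - 1) * t ^ (2 * n) * t ^ 2 := by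
        rw [← Real.rpow_natCast t 2, ← Real.rpow_natCast t (2 * n), ← Real.rpow_add ht,
          ← Real.rpow_add ht]
        -- The shift `u ^ n` bridges the gap `2 l + 1 = 2 n` between the two exponents.
        congr 1; push_cast; rw [hn]; ring
      have e3 : t ^ (l + 1 - 1) = t ^ (-l - 1 - 1) * t ^ (2 * n) * t := by
        rw [Real.rpow_sub_one ht.ne', e2]; field_simp
      have e4 : (z * ((t : ℂ) / 2) ^ 2) ^ n = (z / 4) ^ n * (t : ℂ) ^ (2 * n) := by
        rw [pow_mul, ← mul_pow]; congr 1; ring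
      unfold frob
      rw [e1, e2, e3, e4]
      push_cast
      field_simp
  rw [key]
  unfold singularSol
  push_cast
  simp only [mul_zero, add_zero]
  ring

/-! ### The Green function near the singularity -/

/-- As `|z| ≤ x⁻²`, the factor `z ^ n` turns `y ^ (2 n)` into at most `(y / x) ^ (2 n)`. For `n ≥ 1`
this beats `1 + log (x / y) ≤ x / y`; for `n = 0` the logarithm stays, and `ε = 1` accounts for it.
-/
lemma norm_log_term_le {l κ ε : ℝ} {n : ℕ} (hn : κ = 0 ∨ (n : ℝ) = l + 1 / 2) (hε : 0 ≤ ε)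
    (hεn : κ = 0 ∨ 1 ≤ n ∨ ε = 1) {z : ℂ} {x y : ℝ} (hy : 0 < y) (hyx : y ≤ x)
    (hsx : Real.sqrt ‖z‖ * x ≤ 1) :
    ‖2 * (κ : ℂ) * (z / 4) ^ n‖ * ((1 + Real.log (x / y)) * (x ^ l * y ^ (l + 1))) ≤
      2 * |κ| * ((x / y) ^ l * (1 + ε * Real.log (x / y))) := by
  have hx : 0 < x := hy.trans_le hyx
  have hxy : 1 ≤ x / y := (one_le_div hy).2 hyx
  have hlog : 0 ≤ Real.log (x / y) := Real.log_nonneg hxy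
  set L := Real.log (x / y) with hL
  set T := (x / y) ^ l with hT
  have hT0 : 0 < T := by positivity
  set w := 1 + ε * L with hw
  have hw1 : 1 ≤ w := le_add_of_nonneg_right (mul_nonneg hε hlog)
  have hTx : x ^ l = T * y ^ l := by rw [hT, Real.div_rpow hx.le hy.le]; field_simp
  set c : ℂ := 2 * κ * (z / 4) ^ n with hc
  rcases eq_or_ne κ 0 with h0 | h0
  · simp [hc, h0]
  have hn' := hn.resolve_left h0
  have e1 : x ^ l * y ^ (l + 1) = T * y ^ (2 * n) := by
    rw [hTx, mul_assoc, ← Real.rpow_add hy, ← Real.rpow_natCast]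
    congr 2; push_cast; rw [hn']; ring
  have e2 : ‖c‖ ≤ 2 * |κ| * ((x ^ 2)⁻¹) ^ n := by
    rw [hc, norm_mul, norm_mul, norm_pow, norm_div, Complex.norm_real, Real.norm_eq_abs]
    simp only [Complex.norm_ofNat]
    gcongr
    rw [← one_div, le_div_iff₀ (by positivity), ← Real.sq_sqrt (norm_nonneg z)]
    nlinarith [show 0 ≤ Real.sqrt ‖z‖ * x by positivity]
  have e3 : (1 + L) * (((x ^ 2)⁻¹) ^ n * y ^ (2 * n)) ≤ w := by
    have e4 : ((x ^ 2)⁻¹) ^ n * y ^ (2 * n) = ((x / y)⁻¹ ^ 2) ^ n := by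
      rw [pow_mul, ← mul_pow]; congr 1; field_simp
    rw [e4]
    have e5 : (x / y)⁻¹ ^ 2 ≤ 1 := pow_le_one₀ (by positivity) (inv_le_one_of_one_le₀ hxy)
    rcases hεn.resolve_left h0 with h | h
    · have e6 : 1 + L ≤ x / y := by
        have := Real.log_le_sub_one_of_pos (x := x / y) (by positivity)
        linarith
      calc (1 + L) * ((x / y)⁻¹ ^ 2) ^ n ≤ (x / y) * ((x / y)⁻¹ ^ 2) ^ 1 := by
            gcongr ?_ * ?_
            exact pow_le_pow_of_le_one (by positivity) e5 h
        _ = (x / y)⁻¹ := by field_simp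
        _ ≤ 1 := inv_le_one_of_one_le₀ hxy
        _ ≤ w := hw1
    · rw [hw, h, one_mul]
      exact mul_le_of_le_one_right (by positivity) (pow_le_one₀ (by positivity) e5)
  calc ‖c‖ * ((1 + L) * (x ^ l * y ^ (l + 1)))
      ≤ (2 * |κ| * ((x ^ 2)⁻¹) ^ n) * ((1 + L) * (x ^ l * y ^ (l + 1))) := by gcongr
    _ = 2 * |κ| * (T * ((1 + L) * (((x ^ 2)⁻¹) ^ n * y ^ (2 * n)))) := by rw [e1]; ring
    _ ≤ _ := by gcongr

/-- Behaviour of the Green function near the singularity. -/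
theorem exists_green_bound_near_zero {l κ ε : ℝ} {n : ℕ} {p q : ℕ → ℂ} (hp : EntireCoeff p)
    (hq : EntireCoeff q) (hl : -1 / 2 ≤ l) (hn : κ = 0 ∨ (n : ℝ) = l + 1 / 2) (hε : 0 ≤ ε)
    (hεn : κ = 0 ∨ 1 ≤ n ∨ ε = 1) :
    ∃ C : ℝ, 0 < C ∧ ∀ z x y, 0 < y → y ≤ x → Real.sqrt ‖z‖ * x ≤ 1 →
      ‖frob (l + 1 - 1) (frobDeriv (l + 1) p) z x * singularSol l κ n p q z y
        - frob (l + 1) p z y * singularSolDeriv l κ n p q z x‖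
          ≤ C * (x / y) ^ l * (1 + ε * Real.log (x / y)) ∧
      ‖frob (l + 1) p z x * singularSol l κ n p q z y
        - frob (l + 1) p z y * singularSol l κ n p q z x‖
          ≤ C * x * (x / y) ^ l * (1 + ε * Real.log (x / y)) := by
  set A := ∑' j, ‖p j‖ with hA
  set A' := ∑' j, ‖frobDeriv (l + 1) p j‖ with hA'
  set B := ∑' j, ‖q j‖ with hB
  set B' := ∑' j, ‖frobDeriv (-l) q j‖ with hB'
  have hA0 : 0 ≤ A := tsum_nonneg fun _ => norm_nonneg _
  have hA'0 : 0 ≤ A' := tsum_nonneg fun _ => norm_nonneg _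
  have hB0 : 0 ≤ B := tsum_nonneg fun _ => norm_nonneg _
  have hB'0 : 0 ≤ B' := tsum_nonneg fun _ => norm_nonneg _
  set K := A' * B + A * B' + A * B + A * B + 2 * |κ| * ((A + A') * A) with hK
  refine ⟨K + 1, by positivity, fun z x y hy hyx hsx => ?_⟩
  have hx : 0 < x := hy.trans_le hyx
  have hsy : Real.sqrt ‖z‖ * y ≤ 1 := le_trans (by gcongr) hsx
  have hxy : 1 ≤ x / y := (one_le_div hy).2 hyx
  have hlog : 0 ≤ Real.log (x / y) := Real.log_nonneg hxy
  set L := Real.log (x / y) with hL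
  set T := (x / y) ^ l with hT
  have hT0 : 0 < T := by positivity
  set w := 1 + ε * L with hw
  have hw1 : 1 ≤ w := le_add_of_nonneg_right (mul_nonneg hε hlog)
  have hTx : x ^ l = T * y ^ l := by rw [hT, Real.div_rpow hx.le hy.le]; field_simp
  have hxl : x ^ (l + 1) = x * x ^ l := by rw [Real.rpow_add_one hx.ne', mul_comm]
  have h1 : x ^ l * y ^ (-l) = T := by
    rw [hTx, Real.rpow_neg hy.le, mul_assoc, mul_inv_cancel₀ (by positivity), mul_one]
  have h2 : y ^ (l + 1) * x ^ (-l - 1) ≤ T := by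
    have e1 : y ^ (l + 1) * x ^ (-l - 1) = (x / y) ^ (-(l + 1)) := by
      rw [Real.rpow_neg (by positivity), Real.div_rpow hx.le hy.le, inv_div,
        show -l - 1 = -(l + 1) by ring, Real.rpow_neg hx.le, div_eq_mul_inv]
    rw [e1]
    -- This is where `l ≥ -1/2` matters: `-(l + 1) ≤ l`, so the term carrying the singular solution
    -- at `x` is no larger than the other one.
    exact Real.rpow_le_rpow_of_exponent_le hxy (by linarith)
  have hsub : (Real.log (x / 2) : ℂ) - Real.log (y / 2) = L := by
    rw [hL, Real.log_div hx.ne' hy.ne', Real.log_div hx.ne' two_ne_zero,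
      Real.log_div hy.ne' two_ne_zero]
    push_cast
    ring
  set c : ℂ := 2 * κ * (z / 4) ^ n with hc
  have h3 : ‖c‖ * ((1 + L) * (x ^ l * y ^ (l + 1))) ≤ 2 * |κ| * (T * w) :=
    norm_log_term_le hn hε hεn hy hyx hsx
  have hTw : T ≤ T * w := le_mul_of_one_le_right hT0.le hw1
  have hTw0 : 0 ≤ T * w := hT0.le.trans hTw
  have bp : ∀ t, 0 < t → Real.sqrt ‖z‖ * t ≤ 1 → ‖frob (l + 1) p z t‖ ≤ A * t ^ (l + 1) :=
    fun t ht hst => norm_frob_le hp _ ht hst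
  have bq : ∀ t, 0 < t → Real.sqrt ‖z‖ * t ≤ 1 → ‖frob (-l) q z t‖ ≤ B * t ^ (-l) :=
    fun t ht hst => norm_frob_le hq _ ht hst
  have bp' : ‖frob (l + 1 - 1) (frobDeriv (l + 1) p) z x‖ ≤ A' * x ^ l := by
    simpa using norm_frob_le (hp.frobDeriv (l + 1)) (l + 1 - 1) hx hsx
  have bq' : ‖frob (-l - 1) (frobDeriv (-l) q) z x‖ ≤ B' * x ^ (-l - 1) :=
    norm_frob_le (hq.frobDeriv (-l)) (-l - 1) hx hsx
  have bpx := bp x hx hsx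
  have bpy := bp y hy hsy
  have bqx := bq x hx hsx
  have bqy := bq y hy hsy
  unfold singularSol singularSolDeriv
  rw [← hc]
  clear_value c L T w A A' B B'
  generalize frob (l + 1) p z x = fx at *
  generalize frob (l + 1) p z y = fy at *
  generalize frob (-l) q z x = gx at *
  generalize frob (-l) q z y = gy at *
  generalize frob (l + 1 - 1) (frobDeriv (l + 1) p) z x = fx' at *
  generalize frob (-l - 1) (frobDeriv (-l) q) z x = gx' at *
  constructor
  -- The separate logarithms at `x` and `y` meet with opposite signs and leave only `L`.
  · have e : fx' * (gy - c * (Real.log (y / 2) * fy)) -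
        fy * (gx' - c * ((x⁻¹ : ℝ) * fx + Real.log (x / 2) * fx')) =
        fx' * gy - fy * gx' + c * (((x⁻¹ : ℝ) * fx + (L : ℂ) * fx') * fy) := by
      rw [← hsub]; ring
    rw [e]
    have b1 : ‖fx' * gy‖ ≤ A' * B * (T * w) := by
      rw [norm_mul]
      calc _ ≤ (A' * x ^ l) * (B * y ^ (-l)) := by gcongr
        _ = A' * B * T := by rw [← h1]; ring
        _ ≤ _ := by gcongr
    have b2 : ‖fy * gx'‖ ≤ A * B' * (T * w) := by
      rw [norm_mul]
      calc _ ≤ (A * y ^ (l + 1)) * (B' * x ^ (-l - 1)) := by gcongr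
        _ = A * B' * (y ^ (l + 1) * x ^ (-l - 1)) := by ring
        _ ≤ A * B' * (T * w) := mul_le_mul_of_nonneg_left (h2.trans hTw) (by positivity)
    have b3 : ‖c * (((x⁻¹ : ℝ) * fx + (L : ℂ) * fx') * fy)‖
        ≤ 2 * |κ| * ((A + A') * A) * (T * w) := by
      rw [norm_mul c, norm_mul _ fy]
      have b4 : ‖((x⁻¹ : ℝ) : ℂ) * fx + (L : ℂ) * fx'‖ ≤ (A + A') * ((1 + L) * x ^ l) := by
        refine (norm_add_le _ _).trans ?_
        rw [norm_mul, norm_mul, Complex.norm_real, Complex.norm_real, Real.norm_of_nonneg hlog,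
          Real.norm_of_nonneg (inv_nonneg.2 hx.le)]
        have b5 : x⁻¹ * ‖fx‖ ≤ A * x ^ l := by
          calc x⁻¹ * ‖fx‖ ≤ x⁻¹ * (A * x ^ (l + 1)) := by gcongr
            _ = _ := by rw [hxl]; field_simp
        have b6 : L * ‖fx'‖ ≤ L * (A' * x ^ l) := by gcongr
        have b7 : 0 ≤ A * x ^ l * L := by positivity
        have b8 : 0 ≤ A' * x ^ l := by positivity
        calc x⁻¹ * ‖fx‖ + L * ‖fx'‖
            ≤ A * x ^ l + L * (A' * x ^ l) + (A * x ^ l * L + A' * x ^ l) := by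
              linarith
          _ = _ := by ring
      calc _ ≤ ‖c‖ * ((A + A') * ((1 + L) * x ^ l) * (A * y ^ (l + 1))) := by gcongr
        _ = (A + A') * A * (‖c‖ * ((1 + L) * (x ^ l * y ^ (l + 1)))) := by ring
        _ ≤ (A + A') * A * (2 * |κ| * (T * w)) := by gcongr
        _ = _ := by ring
    have b4 : 0 ≤ A * B * (T * w) := by positivity
    calc _ ≤ ‖fx' * gy‖ + ‖fy * gx'‖ + ‖c * (((x⁻¹ : ℝ) * fx + (L : ℂ) * fx') * fy)‖ :=
          (norm_add_le _ _).trans (add_le_add_left (norm_sub_le _ _) _)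
      _ ≤ (K + 1) * (T * w) := by rw [hK]; linarith
      _ = _ := by ring
  · have e : fx * (gy - c * (Real.log (y / 2) * fy)) -
        fy * (gx - c * (Real.log (x / 2) * fx)) = fx * gy - fy * gx + c * ((L : ℂ) * fx * fy) := by
      rw [← hsub]; ring
    rw [e]
    have b1 : ‖fx * gy‖ ≤ A * B * (x * (T * w)) := by
      rw [norm_mul]
      calc _ ≤ (A * x ^ (l + 1)) * (B * y ^ (-l)) := by gcongr
        _ = A * B * (x * T) := by rw [← h1, hxl]; ring
        _ ≤ _ := by gcongr
    have b2 : ‖fy * gx‖ ≤ A * B * (x * (T * w)) := by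
      rw [norm_mul]
      have e1 : x ^ (-l) = x * x ^ (-l - 1) := by rw [Real.rpow_sub_one hx.ne']; field_simp
      calc _ ≤ (A * y ^ (l + 1)) * (B * x ^ (-l)) := by gcongr
        _ = A * B * (x * (y ^ (l + 1) * x ^ (-l - 1))) := by rw [e1]; ring
        _ ≤ A * B * (x * (T * w)) := mul_le_mul_of_nonneg_left
            (mul_le_mul_of_nonneg_left (h2.trans hTw) hx.le) (by positivity)
    have b3 : ‖c * ((L : ℂ) * fx * fy)‖ ≤ 2 * |κ| * (A * A) * (x * (T * w)) := by
      rw [norm_mul c, norm_mul _ fy, norm_mul, Complex.norm_real, Real.norm_of_nonneg hlog]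
      calc _ ≤ ‖c‖ * ((1 + L) * (A * x ^ (l + 1)) * (A * y ^ (l + 1))) := by
            gcongr; linarith
        _ = A * A * x * (‖c‖ * ((1 + L) * (x ^ l * y ^ (l + 1)))) := by rw [hxl]; ring
        _ ≤ A * A * x * (2 * |κ| * (T * w)) := by gcongr
        _ = _ := by ring
    have b4 : 0 ≤ (A' * B + A * B' + 2 * |κ| * (A' * A) + 1) * (x * (T * w)) := by positivity
    calc _ ≤ ‖fx * gy‖ + ‖fy * gx‖ + ‖c * ((L : ℂ) * fx * fy)‖ :=
          (norm_add_le _ _).trans (add_le_add_left (norm_sub_le _ _) _)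
      _ ≤ (K + 1) * (x * (T * w)) := by rw [hK]; linarith
      _ = _ := by ring

/-! ### The differential equation as a recursion -/

lemma EntireCoeff.of_norm_le {c d : ℕ → ℂ} (hc : EntireCoeff c) (h : ∀ j, ‖d j‖ ≤ ‖c j‖) :
    EntireCoeff d := fun r hr =>
  Summable.of_nonneg_of_le (fun _ => by positivity)
    (fun j => mul_le_mul_of_nonneg_right (h j) (by positivity)) (hc r hr)

lemma EntireCoeff.powerSum_succ {c : ℕ → ℂ} (hc : EntireCoeff c) (u : ℂ) :
    powerSum c u = c 0 + u * powerSum (fun j => c (j + 1)) u := by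
  unfold powerSum
  rw [(hc.summable u).tsum_eq_zero_add, ← tsum_mul_left]
  simp only [pow_zero, mul_one, pow_succ]
  congr 1
  exact tsum_congr fun j => by ring

/-- The sequence `a 0, …, a (n - 1), e 0, e 1, …`. -/
def prependCoeff (n : ℕ) (a e : ℕ → ℂ) : ℕ → ℂ := fun j => if j < n then a j else e (j - n)

lemma EntireCoeff.prependCoeff {e : ℕ → ℂ} (he : EntireCoeff e) (n : ℕ) (a : ℕ → ℂ) :
    EntireCoeff (prependCoeff n a e) := by
  intro r hr
  rw [← summable_nat_add_iff n]
  refine ((he r hr).mul_right (r ^ n)).congr fun j => ?_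
  simp [SphericalSchrodinger.prependCoeff, pow_add, mul_assoc]

lemma powerSum_prependCoeff {e : ℕ → ℂ} (he : EntireCoeff e) (n : ℕ) (a : ℕ → ℂ) (u : ℂ) :
    powerSum (prependCoeff n a e) u =
      (∑ j ∈ Finset.range n, a j * u ^ j) + u ^ n * powerSum e u := by
  unfold powerSum
  rw [← ((he.prependCoeff n a).summable u).sum_add_tsum_nat_add n, ← tsum_mul_left]
  congr 1
  · refine Finset.sum_congr rfl fun j hj => ?_
    simp [prependCoeff, Finset.mem_range.1 hj]
  · refine tsum_congr fun j => ?_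
    simp [prependCoeff, pow_add]
    ring

/-- The identity `(α + 2 j) (α - 1 + 2 j) = α (α - 1) + 4 j (j + α - 1/2)` reduces the equation to a
two-term recursion. At index `0` it holds because `α` is an indicial root and `r 0 = 0`. -/
lemma powerSum_ode {α : ℝ} {c r : ℕ → ℂ} (hc : EntireCoeff c) (hr : EntireCoeff r) (hr0 : r 0 = 0)
    (h : ∀ j : ℕ, 4 * ((j : ℂ) + 1) * (j + 1 + (α - 1 / 2)) * c (j + 1) + 4 * c j = r (j + 1))
    (u : ℂ) :
    powerSum (frobDeriv (α - 1) (frobDeriv α c)) u =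
      (((α * (α - 1) : ℝ) : ℂ) - 4 * u) * powerSum c u + powerSum r u := by
  have hD := (hc.frobDeriv α).frobDeriv (α - 1)
  rw [hD.powerSum_succ, hr.powerSum_succ, hr0, sub_mul]
  nth_rw 1 [hc.powerSum_succ]
  have hs : ∀ {d : ℕ → ℂ}, EntireCoeff d → Summable fun j => d (j + 1) * u ^ j := by
    intro d hd
    -- Summability of the shifted series is obtained by dividing by `u`, so `u = 0` is separate.
    rcases eq_or_ne u 0 with rfl | hu
    · exact summable_of_ne_finset_zero (s := {0}) fun j hj => by
        simp [zero_pow (Finset.notMem_singleton.1 hj)]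
    · refine (((summable_nat_add_iff 1).2 (hd.summable u)).mul_right u⁻¹).congr fun j => ?_
      field_simp
      ring
  have e : powerSum (fun j => frobDeriv (α - 1) (frobDeriv α c) (j + 1)) u =
      ((α * (α - 1) : ℝ) : ℂ) * powerSum (fun j => c (j + 1)) u
        + (powerSum (fun j => r (j + 1)) u - 4 * powerSum c u) := by
    unfold powerSum
    rw [← tsum_mul_left, ← tsum_mul_left, ← (hs hr).tsum_sub ((hc.summable u).mul_left 4),
      ← ((hs hc).mul_left _).tsum_add ((hs hr).sub ((hc.summable u).mul_left 4))]
    refine tsum_congr fun j => ?_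
    rw [← h j]
    unfold frobDeriv
    push_cast
    ring
  rw [e]
  unfold frobDeriv
  push_cast
  ring

/-! ### Bessel and Neumann coefficients -/

/-- The coefficients of the power series in the Bessel function. -/
def besselCoeff (ν : ℝ) (k : ℕ) : ℂ := (-1 : ℂ) ^ k / ((k ! : ℂ) * (Real.Gamma (ν + k + 1) : ℂ))

/-- This is `Γ(w + 1) = w Γ(w)`. It survives the poles: there `Γ = 0` and division by zero make the
coefficient vanish, and at `w = 0` the left factor vanishes too. -/
lemma besselCoeff_succ (ν : ℝ) (k : ℕ) :
    ((k : ℂ) + 1) * (k + 1 + ν) * besselCoeff ν (k + 1) = -besselCoeff ν k := by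
  unfold besselCoeff
  have hk : ((k : ℂ) + 1) ≠ 0 := by exact_mod_cast k.succ_ne_zero
  have hk' : (k ! : ℂ) ≠ 0 := by exact_mod_cast k.factorial_ne_zero
  have e : ν + (k + 1 : ℕ) + 1 = (ν + k + 1) + 1 := by push_cast; ring
  rw [e, Nat.factorial_succ]
  rcases eq_or_ne (ν + k + 1) 0 with h0 | h0
  · have h1 : (k : ℂ) + 1 + ν = 0 := by
      have : ((ν + k + 1 : ℝ) : ℂ) = 0 := by rw [h0]; simp
      push_cast at this
      linear_combination this
    rw [h0, h1, Real.Gamma_zero]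
    simp
  · have h1 : (k : ℂ) + 1 + ν ≠ 0 := by
      intro h
      apply h0
      have : ((ν + k + 1 : ℝ) : ℂ) = 0 := by push_cast; linear_combination h
      exact_mod_cast this
    rw [Real.Gamma_add_one h0, pow_succ]
    have h2 : (((ν + k + 1) : ℝ) : ℂ) = k + 1 + ν := by push_cast; ring
    push_cast [h2]
    rcases eq_or_ne ((Real.Gamma (ν + k + 1) : ℝ) : ℂ) 0 with h3 | h3
    · rw [h3]; simp
    · field_simp

lemma entireCoeff_besselCoeff (ν : ℝ) : EntireCoeff (besselCoeff ν) := by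
  refine EntireCoeff.of_ratio (fun k => ((k : ℝ) + 1) * (k + 1 + ν)) ?_ fun k => ?_
  · have h1 : Filter.Tendsto (fun k : ℕ => (k : ℝ) + 1) Filter.atTop Filter.atTop :=
      Filter.tendsto_atTop_add_const_right _ _ tendsto_natCast_atTop_atTop
    exact h1.atTop_mul_atTop₀ (Filter.tendsto_atTop_add_const_right _ _ h1)
  · have h := congrArg norm (besselCoeff_succ ν k)
    rw [norm_mul, norm_neg] at h
    rw [← h]
    refine mul_le_mul_of_nonneg_right ?_ (norm_nonneg _)
    have : ((k : ℂ) + 1) * (k + 1 + ν) = ((((k : ℝ) + 1) * (k + 1 + ν) : ℝ) : ℂ) := by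
      push_cast; ring
    rw [this, Complex.norm_real]
    exact Real.le_norm_self _

lemma besselCoeff_ode {α ν : ℝ} (hν : ν = α - 1 / 2) (u : ℂ) :
    powerSum (frobDeriv (α - 1) (frobDeriv α (besselCoeff ν))) u =
      (((α * (α - 1) : ℝ) : ℂ) - 4 * u) * powerSum (besselCoeff ν) u := by
  have h0 : EntireCoeff (fun _ => 0) := fun r _ => by simp
  rw [powerSum_ode (entireCoeff_besselCoeff ν) h0 rfl (fun j => ?_)]
  · simp [powerSum]
  · have := besselCoeff_succ ν j
    rw [hν] at this ⊢
    push_cast at this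
    linear_combination 4 * this

lemma besselCoeff_natCast (n k : ℕ) :
    besselCoeff n k = (-1 : ℂ) ^ k / ((k ! : ℂ) * ((n + k)! : ℂ)) := by
  unfold besselCoeff
  rw [← Nat.cast_add, Real.Gamma_nat_eq_factorial]
  norm_cast

/-- The coefficients of the second power series in the Neumann function. -/
def neumannLogCoeff (n k : ℕ) : ℂ :=
  ((harmonic k : ℂ) + (harmonic (n + k) : ℂ) - 2 * (Real.eulerMascheroniConstant : ℂ)) *
    besselCoeff n k

lemma norm_harmonic_le (k : ℕ) : ‖(harmonic k : ℂ)‖ ≤ k := by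
  induction k with
  | zero => simp
  | succ k ih =>
    rw [harmonic_succ]
    push_cast
    refine (norm_add_le _ _).trans (add_le_add ih ?_)
    rw [norm_inv]
    refine inv_le_one_of_one_le₀ ?_
    rw [← Nat.cast_succ, Complex.norm_natCast]
    exact_mod_cast Nat.succ_pos k

/-- The harmonic factors grow at most linearly, so an affine multiple of the Bessel coefficients
dominates. -/
lemma entireCoeff_neumannLogCoeff (n : ℕ) : EntireCoeff (neumannLogCoeff n) := by
  set K : ℝ := n + ‖2 * (Real.eulerMascheroniConstant : ℂ)‖ with hK
  refine ((entireCoeff_besselCoeff n).affine_mul (K : ℂ) 2).of_norm_le fun k => ?_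
  unfold neumannLogCoeff
  rw [norm_mul, norm_mul]
  refine mul_le_mul_of_nonneg_right ?_ (norm_nonneg _)
  have h1 : (K : ℂ) + 2 * k = ((K + 2 * k : ℝ) : ℂ) := by push_cast; ring
  rw [h1, Complex.norm_real, Real.norm_of_nonneg (by positivity)]
  have h2 := norm_harmonic_le k
  have h3 := norm_harmonic_le (n + k)
  push_cast at h3
  refine (norm_sub_le _ _).trans ?_
  have := norm_add_le (harmonic k : ℂ) (harmonic (n + k) : ℂ)
  linarith

/-- The coefficients of the power series in the Neumann function, the logarithmic term being
left out. -/
def neumannCoeff (n : ℕ) : ℕ → ℂ :=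
  prependCoeff n (fun k => ((n - k - 1)! : ℂ) / (k ! : ℂ)) (neumannLogCoeff n)

lemma entireCoeff_neumannCoeff (n : ℕ) : EntireCoeff (neumannCoeff n) :=
  (entireCoeff_neumannLogCoeff n).prependCoeff _ _

/-- With `α = -l` the recursion factor is `4 (j + 1) (j + 1 - n)`. It vanishes at `j + 1 = n`, the
resonance that forces a logarithm; beyond it, the increments of the harmonic numbers produce the
source. -/
lemma neumannCoeff_ode {l : ℝ} {n : ℕ} (hn : (n : ℝ) = l + 1 / 2) (u : ℂ) :
    powerSum (frobDeriv (-l - 1) (frobDeriv (-l) (neumannCoeff n))) u =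
      (((l * (l + 1) : ℝ) : ℂ) - 4 * u) * powerSum (neumannCoeff n) u +
        2 * (1 : ℝ) * u ^ n * powerSum (fun j => (2 * l + 1 + 4 * j) * besselCoeff n j) u := by
  have hb := entireCoeff_besselCoeff n
  have he := hb.affine_mul (2 * (2 * l + 1)) (2 * 4)
  have hn' : (l : ℂ) = n - 1 / 2 := by
    have : ((n : ℝ) : ℂ) = ((l + 1 / 2 : ℝ) : ℂ) := by rw [hn]
    push_cast at this
    linear_combination -this
  have h1 : ∀ u, powerSum (prependCoeff n 0 fun j => (2 * (2 * l + 1) + 2 * 4 * j) * besselCoeff n j)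
      u = 2 * u ^ n * powerSum (fun j => (2 * l + 1 + 4 * j) * besselCoeff n j) u := by
    intro u
    rw [powerSum_prependCoeff he, hb.powerSum_affine_mul, hb.powerSum_affine_mul]
    simp
    ring
  have h2 := powerSum_ode (α := -l) (entireCoeff_neumannCoeff n) (he.prependCoeff n 0) ?_ ?_ u
  · rw [h2, h1]
    push_cast
    ring
  -- For `n = 0` the source starts at index `0`, but its coefficient there is a multiple of `2 l + 1
  -- = 0`.
  · rcases n with _ | n
    · simp [prependCoeff, hn']
    · simp [prependCoeff]
  · intro j
    push_cast
    rw [hn']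
    rcases lt_trichotomy (j + 1) n with h | h | h
    · obtain ⟨i, rfl⟩ := Nat.exists_eq_add_of_lt h
      have e1 : j < j + 1 + i + 1 := by omega
      have e2 : j + 1 + i + 1 - (j + 1) - 1 = i := by omega
      have e3 : j + 1 + i + 1 - j - 1 = i + 1 := by omega
      simp only [neumannCoeff, prependCoeff, h, e1, if_true, e2, e3, Nat.factorial_succ,
        Pi.zero_apply]
      have hk : ((j : ℂ) + 1) ≠ 0 := by exact_mod_cast j.succ_ne_zero
      have hk' : (j ! : ℂ) ≠ 0 := by exact_mod_cast j.factorial_ne_zero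
      push_cast
      field_simp
      ring
    -- At resonance the unknown coefficient drops out, and the last term of the finite sum must
    -- match the first term of the source.
    · subst h
      have hk : ((j : ℂ) + 1) ≠ 0 := by exact_mod_cast j.succ_ne_zero
      have hk' : (j ! : ℂ) ≠ 0 := by exact_mod_cast j.factorial_ne_zero
      simp only [neumannCoeff, prependCoeff, besselCoeff_natCast, lt_irrefl, if_false,
        Nat.lt_succ_self, if_true, Nat.sub_self, Nat.add_sub_cancel_left, Nat.factorial_succ]
      push_cast
      field_simp
      simp
      ring
    · obtain ⟨k, rfl⟩ : ∃ k, j = n + k := ⟨j - n, by omega⟩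
      have e1 : ¬ n + k + 1 < n := by omega
      have e2 : ¬ n + k < n := by omega
      have e3 : n + k + 1 - n = k + 1 := by omega
      have e4 : n + k - n = k := by omega
      simp only [neumannCoeff, prependCoeff, e1, e2, e3, e4, if_false, neumannLogCoeff]
      have hr := besselCoeff_succ n k
      rw [neg_eq_iff_eq_neg.symm] at hr
      rw [← hr, harmonic_succ, show n + (k + 1) = (n + k) + 1 by ring, harmonic_succ]
      have hk : ((k : ℂ) + 1) ≠ 0 := by exact_mod_cast k.succ_ne_zero
      have hk' : ((n : ℂ) + k + 1) ≠ 0 := by exact_mod_cast (n + k).succ_ne_zero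
      push_cast
      field_simp
      ring

/-! ### Principal branches and identification of the two solutions -/

/-- Halving an argument in `(-π, π]` keeps it in the principal strip. -/
lemma log_sqrt {z : ℂ} (hz : z ≠ 0) : Complex.log (z ^ (1 / 2 : ℂ)) = Complex.log z / 2 := by
  rw [Complex.cpow_def_of_ne_zero hz, mul_one_div, Complex.log_exp]
  · have := Complex.neg_pi_lt_log_im z
    rw [show (2 : ℂ) = ((2 : ℝ) : ℂ) by simp, Complex.div_ofReal_im]
    linarith [Real.pi_pos]
  · have := Complex.log_im_le_pi z
    rw [show (2 : ℂ) = ((2 : ℝ) : ℂ) by simp, Complex.div_ofReal_im]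
    linarith [Real.pi_pos]

lemma sqrt_ne_zero {z : ℂ} (hz : z ≠ 0) : z ^ (1 / 2 : ℂ) ≠ 0 := by
  rw [Ne, Complex.cpow_eq_zero_iff]
  exact fun h => hz h.1

lemma log_sqrt_mul_half {z : ℂ} (hz : z ≠ 0) {t : ℝ} (ht : 0 < t) :
    Complex.log (z ^ (1 / 2 : ℂ) * t / 2) = Complex.log z / 2 + Real.log (t / 2) := by
  have e : z ^ (1 / 2 : ℂ) * t / 2 = ((t / 2 : ℝ) : ℂ) * z ^ (1 / 2 : ℂ) := by push_cast; ring
  rw [e, Complex.log_ofReal_mul (by positivity) (sqrt_ne_zero hz), log_sqrt hz, add_comm]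

lemma sqrt_mul_half_cpow {z : ℂ} (hz : z ≠ 0) {t : ℝ} (ht : 0 < t) (ν : ℝ) :
    (z ^ (1 / 2 : ℂ) * t / 2) ^ (ν : ℂ) = z ^ ((ν : ℂ) / 2) * (((t / 2) ^ ν : ℝ) : ℂ) := by
  have ht' : (t : ℂ) ≠ 0 := by exact_mod_cast ht.ne'
  have h0 : z ^ (1 / 2 : ℂ) * t / 2 ≠ 0 :=
    div_ne_zero (mul_ne_zero (sqrt_ne_zero hz) ht') two_ne_zero
  rw [Complex.cpow_def_of_ne_zero h0, log_sqrt_mul_half hz ht, Complex.cpow_def_of_ne_zero hz,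
    Real.rpow_def_of_pos (by positivity), add_mul, Complex.exp_add]
  push_cast
  congr 2
  ring

lemma sqrt_mul_half_sq (z : ℂ) (t : ℝ) :
    (z ^ (1 / 2 : ℂ) * t / 2) ^ 2 = z * ((t : ℂ) / 2) ^ 2 := by
  rw [mul_div_assoc, mul_pow]
  simp

lemma besselJ_sqrt_mul {z : ℂ} (hz : z ≠ 0) {t : ℝ} (ht : 0 < t) (ν : ℝ) :
    besselJ ν (z ^ (1 / 2 : ℂ) * t) = z ^ ((ν : ℂ) / 2) * (((t / 2) ^ ν : ℝ) : ℂ) *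
      powerSum (besselCoeff ν) (z * ((t : ℂ) / 2) ^ 2) := by
  unfold besselJ powerSum besselCoeff
  rw [sqrt_mul_half_cpow hz ht, ← sqrt_mul_half_sq]
  simp only [pow_mul]

lemma sqrt_pi_mul_half (t : ℝ) :
    Real.sqrt (Real.pi * t / 2) = Real.sqrt Real.pi * (t / 2) ^ (1 / 2 : ℝ) := by
  rw [mul_div_assoc, Real.sqrt_mul Real.pi_pos.le, Real.sqrt_eq_rpow (t / 2)]

lemma powerSum_zero_right (c : ℕ → ℂ) : powerSum c 0 = c 0 := by
  unfold powerSum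
  rw [tsum_eq_single 0 fun j hj => by simp [hj]]
  simp

/-- The prefactor `z ^ (-ν / 2)`, `ν = l + 1/2`, cancels the branch factor of `besselJ`, leaving a
formula that is also right at `z = 0`. -/
lemma phi_eq_frob (l : ℝ) (z : ℂ) {t : ℝ} (ht : 0 < t) :
    phi l z t = ((Real.sqrt Real.pi * (2 ^ (l + 1))⁻¹ : ℝ) : ℂ) *
      frob (l + 1) (besselCoeff (l + 1 / 2)) z t := by
  unfold phi frob
  split_ifs with hz
  · rw [hz, zero_mul, powerSum_zero_right]
    simp only [besselCoeff]
    rw [show l + 1 / 2 + ((0 : ℕ) : ℝ) + 1 = l + 3 / 2 by push_cast; ring]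
    push_cast
    simp
    ring
  · rw [besselJ_sqrt_mul hz ht, sqrt_pi_mul_half,
      show -(2 * (l : ℂ) + 1) / 4 = -(((l + 1 / 2 : ℝ) : ℂ) / 2) by push_cast; ring,
      Complex.cpow_neg]
    have h0 : z ^ (((l + 1 / 2 : ℝ) : ℂ) / 2) ≠ 0 := by
      rw [Ne, Complex.cpow_eq_zero_iff]; exact fun h => hz h.1
    have h1 : t ^ (l + 1) * (2 ^ (l + 1))⁻¹ = (t / 2) ^ (1 / 2 : ℝ) * (t / 2) ^ (l + 1 / 2) := by
      rw [← Real.rpow_add (by positivity), show 1 / 2 + (l + 1 / 2) = l + 1 by ring,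
        Real.div_rpow ht.le two_pos.le, div_eq_mul_inv]
    have h2 := congrArg (fun r : ℝ => (r : ℂ)) h1
    generalize z ^ (((l + 1 / 2 : ℝ) : ℂ) / 2) = ζ at *
    generalize powerSum (besselCoeff (l + 1 / 2)) (z * ((t : ℂ) / 2) ^ 2) = P
    simp only [Complex.ofReal_mul] at h2 ⊢
    have h3 := inv_mul_cancel₀ h0
    linear_combination ((Real.sqrt Real.pi : ℂ) * ((t / 2) ^ (1 / 2 : ℝ) : ℝ) *
      ((t / 2) ^ (l + 1 / 2) : ℝ) * P) * h3 - (Real.sqrt Real.pi : ℂ) * P * h2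

lemma theta_eq_of_not_natCast {l : ℝ} (hl : -1 / 2 ≤ l) (h : (⌊l + 1 / 2⌋₊ : ℝ) ≠ l + 1 / 2)
    (z : ℂ) {t : ℝ} (ht : 0 < t) :
    theta l z t = ((Real.sqrt Real.pi * 2 ^ l / Real.sin ((l + 1 / 2) * Real.pi) : ℝ) : ℂ) *
      frob (-l) (besselCoeff (-l - 1 / 2)) z t := by
  have hl' : l ≠ -1 / 2 := by
    rintro rfl
    norm_num at h
  have hν : 0 < l + 1 / 2 := by
    rcases hl.lt_or_eq with h | h
    · linarith
    · exact absurd h.symm hl'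
  have hpi : Real.sqrt Real.pi * Real.sqrt Real.pi = Real.pi := Real.mul_self_sqrt Real.pi_pos.le
  have hpi0 : 0 < Real.sqrt Real.pi := Real.sqrt_pos.2 Real.pi_pos
  have h2l : (2 : ℝ) ^ l ≠ 0 := (Real.rpow_pos_of_pos two_pos l).ne'
  unfold theta frob
  split_ifs with hz
  · rw [hz, zero_mul, powerSum_zero_right]
    simp only [besselCoeff, pow_zero, Nat.factorial_zero, Nat.cast_one, one_mul]
    rw [← Complex.ofReal_one, ← Complex.ofReal_div, ← Complex.ofReal_mul, ← Complex.ofReal_mul]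
    congr 1
    -- The reflection formula matches the prescribed value at `z = 0` with the leading Bessel
    -- coefficient.
    have h1 := Real.Gamma_mul_Gamma_one_sub (l + 1 / 2)
    have h2 := Real.Gamma_add_one hν.ne'
    have hs : Real.sin ((l + 1 / 2) * Real.pi) ≠ 0 := by
      intro hs
      rw [Real.sin_eq_zero_iff] at hs
      obtain ⟨k, hk⟩ := hs
      have hk' : (k : ℝ) = l + 1 / 2 := mul_right_cancel₀ Real.pi_ne_zero hk
      have hk0 : 0 ≤ k := by
        have : (0 : ℝ) < k := hk'.symm ▸ hν
        exact_mod_cast this.le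
      obtain ⟨m, rfl⟩ := Int.eq_ofNat_of_zero_le hk0
      apply h
      rw [← hk']
      simp
    rw [mul_comm Real.pi] at h1
    rw [show l + 3 / 2 = l + 1 / 2 + 1 by ring, h2,
      show -l - 1 / 2 + ((0 : ℕ) : ℝ) + 1 = 1 - (l + 1 / 2) by push_cast; ring,
      Real.rpow_add_one two_ne_zero]
    have h3 : Real.Gamma (1 - (l + 1 / 2)) ≠ 0 := by
      intro h0
      rw [h0, mul_zero] at h1
      exact (div_ne_zero Real.pi_ne_zero hs) h1.symm
    have h4 : 2 * l + 1 ≠ 0 := by linarith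
    rw [eq_div_iff hs] at h1
    generalize Real.Gamma (1 - (l + 1 / 2)) = G₁ at *
    generalize Real.Gamma (l + 1 / 2) = G₂ at *
    generalize Real.sin ((l + 1 / 2) * Real.pi) = σ at *
    rw [← hpi] at h1
    rw [show l + 1 / 2 = (2 * l + 1) / 2 by ring]
    generalize 2 * l + 1 = d at *
    generalize Real.sqrt Real.pi = S at *
    field_simp
    linear_combination h1
  · rw [show -l - 1 / 2 = -(l + 1 / 2) by ring, besselJ_sqrt_mul hz ht, sqrt_pi_mul_half,
      show (2 * (l : ℂ) + 1) / 4 = ((l + 1 / 2 : ℝ) : ℂ) / 2 by push_cast; ring,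
      Complex.ofReal_neg, neg_div _ (((l + 1 / 2 : ℝ) : ℂ)), Complex.cpow_neg]
    have h0 : z ^ (((l + 1 / 2 : ℝ) : ℂ) / 2) ≠ 0 := by
      rw [Ne, Complex.cpow_eq_zero_iff]; exact fun h => hz h.1
    have h1 : t ^ (-l) * 2 ^ l = (t / 2) ^ (1 / 2 : ℝ) * (t / 2) ^ (-(l + 1 / 2)) := by
      rw [← Real.rpow_add (by positivity), show 1 / 2 + -(l + 1 / 2) = -l by ring,
        Real.div_rpow ht.le two_pos.le, Real.rpow_neg two_pos.le, div_inv_eq_mul]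
    have h2 := congrArg (fun r : ℝ => (r : ℂ)) h1
    generalize z ^ (((l + 1 / 2 : ℝ) : ℂ) / 2) = ζ at *
    generalize powerSum (besselCoeff (-(l + 1 / 2))) (z * ((t : ℂ) / 2) ^ 2) = P
    simp only [Complex.ofReal_mul, Complex.ofReal_div _ (Real.sin _)] at h2 ⊢
    have h3 := mul_inv_cancel₀ h0
    generalize ((Real.sin ((l + 1 / 2) * Real.pi) : ℝ) : ℂ) = σ
    linear_combination ((Real.sqrt Real.pi : ℂ) * ((t / 2) ^ (1 / 2 : ℝ) : ℝ) *
      ((t / 2) ^ (-(l + 1 / 2)) : ℝ) * P / σ) * h3 - (Real.sqrt Real.pi : ℂ) * P / σ * h2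

/-- Since `log (√z t / 2) = log z / 2 + log (t / 2)`, subtracting `log z / π` times `J` removes the
branch of `log z`. Only `log (t / 2)` survives, which is the logarithm in `singularSol`. -/
lemma theta_eq_of_natCast {l : ℝ} {n : ℕ} (hn : (n : ℝ) = l + 1 / 2)
    (z : ℂ) {t : ℝ} (ht : 0 < t) :
    theta l z t = ((Real.sqrt Real.pi * 2 ^ l / Real.pi : ℝ) : ℂ) *
      singularSol l 1 n (besselCoeff (l + 1 / 2)) (neumannCoeff n) z t := by
  have hl : l = n - 1 / 2 := by linarith
  have hpi : Real.sqrt Real.pi * Real.sqrt Real.pi = Real.pi := Real.mul_self_sqrt Real.pi_pos.le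
  have hpi0 : 0 < Real.sqrt Real.pi := Real.sqrt_pos.2 Real.pi_pos
  have h2l : (2 : ℝ) ^ l ≠ 0 := (Real.rpow_pos_of_pos two_pos l).ne'
  unfold theta singularSol frob
  rw [← hn, Nat.floor_natCast, if_pos rfl]
  split_ifs with hz hl0
  · have hn0 : n = 0 := by
      have : (n : ℝ) = 0 := by rw [hn, hl0]; norm_num
      exact_mod_cast this
    subst hn0
    rw [hz, zero_mul, powerSum_zero_right, powerSum_zero_right, hl0]
    have h1 : neumannCoeff 0 0 = -(2 * (Real.eulerMascheroniConstant : ℂ)) := by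
      simp [neumannCoeff, prependCoeff, neumannLogCoeff, besselCoeff]
    have h2 : besselCoeff ((0 : ℕ) : ℝ) 0 = 1 := by simp [besselCoeff]
    rw [h1, h2, Real.log_div ht.ne' two_ne_zero, show (-1 / 2 : ℝ) + 1 = 1 / 2 by norm_num,
      show -(-1 / 2 : ℝ) = 1 / 2 by norm_num, mul_div_right_comm, Real.sqrt_mul (by positivity),
      Real.sqrt_div two_pos.le, Real.sqrt_eq_rpow t, neg_div, Real.rpow_neg two_pos.le,
      ← Real.sqrt_eq_rpow 2]
    have h3 : Real.sqrt 2 / Real.sqrt Real.pi =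
        2 * (Real.sqrt Real.pi * (Real.sqrt 2)⁻¹ / Real.pi) := by
      have : Real.sqrt 2 * Real.sqrt 2 = 2 := Real.mul_self_sqrt two_pos.le
      have h5 : Real.sqrt 2 ≠ 0 := (Real.sqrt_pos.2 two_pos).ne'
      generalize Real.sqrt Real.pi = S at *
      rw [← hpi]
      field_simp
      linear_combination this
    rw [h3]
    push_cast
    ring
  · have hn0 : n ≠ 0 := by
      rintro rfl
      apply hl0
      linarith
    obtain ⟨m, rfl⟩ := Nat.exists_eq_succ_of_ne_zero hn0
    rw [hz, zero_mul, powerSum_zero_right, powerSum_zero_right]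
    have h1 : neumannCoeff (m + 1) 0 = (m ! : ℝ) := by
      simp [neumannCoeff, prependCoeff]
    have h2 : l + 3 / 2 = ((m + 1 : ℕ) : ℝ) + 1 := by rw [hn]; ring
    have h3 : 2 * l + 1 = 2 * ((m : ℝ) + 1) := by rw [hl]; push_cast; ring
    rw [Nat.succ_eq_add_one, h1, h2, h3, Real.Gamma_nat_eq_factorial, zero_div,
      zero_pow m.succ_ne_zero, mul_zero, zero_mul, sub_zero, ← Complex.ofReal_mul,
      ← Complex.ofReal_mul, Nat.factorial_succ, Real.rpow_add_one two_ne_zero]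
    congr 1
    generalize Real.sqrt Real.pi = S at *
    rw [← hpi]
    have h4 : (m : ℝ) + 1 ≠ 0 := by positivity
    push_cast
    field_simp
  · have ht' : (t : ℂ) ≠ 0 := by exact_mod_cast ht.ne'
    have hw : z ^ (1 / 2 : ℂ) * t / 2 ≠ 0 :=
      div_ne_zero (mul_ne_zero (sqrt_ne_zero hz) ht') two_ne_zero
    -- As `2 l + 1 = 2 n`, this is an integral power of `√z` and cancels the negative power in
    -- `besselY`.
    have hζ : z ^ ((2 * (l : ℂ) + 1) / 4) = (z ^ (1 / 2 : ℂ)) ^ n := by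
      rw [← Complex.cpow_mul_nat]
      congr 1
      rw [hl]
      push_cast
      ring
    have hJ := besselJ_sqrt_mul hz ht n
    have hJζ : z ^ (((n : ℝ) : ℂ) / 2) = (z ^ (1 / 2 : ℂ)) ^ n := by
      rw [← Complex.cpow_mul_nat]
      congr 1
      push_cast
      ring
    rw [hJζ, Real.rpow_natCast] at hJ
    have hq : powerSum (neumannCoeff n) (z * ((t : ℂ) / 2) ^ 2) = _ :=
      powerSum_prependCoeff (entireCoeff_neumannLogCoeff n) n _ _
    have hlc : powerSum (neumannLogCoeff n) (z * ((t : ℂ) / 2) ^ 2) =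
        ∑' k : ℕ, ((harmonic k : ℂ) + (harmonic (n + k) : ℂ)
          - 2 * (Real.eulerMascheroniConstant : ℂ)) * (-1 : ℂ) ^ k / ((k ! : ℂ) * ((n + k)! : ℂ)) *
          (z ^ (1 / 2 : ℂ) * t / 2) ^ (2 * k) := by
      unfold powerSum
      refine tsum_congr fun k => ?_
      rw [pow_mul, sqrt_mul_half_sq, neumannLogCoeff, besselCoeff_natCast]
      ring
    have hsum : ∑ k ∈ Finset.range n, ((n - k - 1)! : ℂ) / (k ! : ℂ) *
          (z ^ (1 / 2 : ℂ) * t / 2) ^ (2 * k) = ∑ k ∈ Finset.range n,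
          ((n - k - 1)! : ℂ) / (k ! : ℂ) * (z * ((t : ℂ) / 2) ^ 2) ^ k := by
      simp only [pow_mul, sqrt_mul_half_sq]
    rw [hq]
    unfold besselY
    rw [← hlc, hsum, hJ, log_sqrt_mul_half hz ht, hζ, sqrt_pi_mul_half]
    have h1 : t ^ (-l) * 2 ^ l * (t / 2) ^ n = (t / 2) ^ (1 / 2 : ℝ) := by
      rw [← Real.rpow_natCast, hn, ← div_inv_eq_mul (t ^ (-l)), ← Real.rpow_neg two_pos.le,
        ← Real.div_rpow ht.le two_pos.le, ← Real.rpow_add (by positivity)]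
      congr 1
      ring
    have h2 : t ^ (l + 1) = t ^ (-l) * (t ^ 2) ^ n := by
      rw [← pow_mul, ← Real.rpow_natCast, ← Real.rpow_add ht]
      congr 1
      push_cast
      rw [hn]
      ring
    have h3 : z = z ^ (1 / 2 : ℂ) * z ^ (1 / 2 : ℂ) := by rw [← sq]; simp
    rw [← h1, h2]
    generalize ∑ k ∈ Finset.range n,
          ((n - k - 1)! : ℂ) / (k ! : ℂ) * (z * ((t : ℂ) / 2) ^ 2) ^ k = E₁
    generalize powerSum (neumannLogCoeff n) (z * ((t : ℂ) / 2) ^ 2) = E₂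
    generalize powerSum (besselCoeff n) (z * ((t : ℂ) / 2) ^ 2) = E₃
    generalize Complex.log z = Λ
    have h4 : z ^ (1 / 2 : ℂ) ≠ 0 := sqrt_ne_zero hz
    generalize z ^ (1 / 2 : ℂ) = k at *
    rw [h3]
    have hpi' : (Real.pi : ℂ) ≠ 0 := by exact_mod_cast Real.pi_ne_zero
    push_cast
    rw [show (4 : ℂ) = 2 ^ 2 by norm_num]
    simp only [div_pow, mul_pow]
    field_simp
    ring_nf
    rw [show (2 : ℂ) ^ (n * 2) = 4 ^ n by rw [mul_comm, pow_mul]; norm_num]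

lemma besselCoeff_ode_regular (l : ℝ) (u : ℂ) :
    powerSum (frobDeriv (l + 1 - 1) (frobDeriv (l + 1) (besselCoeff (l + 1 / 2)))) u =
      (((l * (l + 1) : ℝ) : ℂ) - 4 * u) * powerSum (besselCoeff (l + 1 / 2)) u := by
  rw [besselCoeff_ode (by ring), show (l + 1) * (l + 1 - 1) = l * (l + 1) by ring]

/-- Both definitions of `theta` are brought to one form, with `κ` switching the logarithm on (`1`)
or off (`0`); in the latter case `n = 0` is a dummy value. -/
lemma exists_theta_eq_singularSol {l : ℝ} (hl : -1 / 2 ≤ l) :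
    ∃ (κ B : ℝ) (n : ℕ) (q : ℕ → ℂ), EntireCoeff q ∧ (κ = 0 ∨ (n : ℝ) = l + 1 / 2) ∧
      (κ = 0 ∨ 1 ≤ n ∨ l = -1 / 2) ∧
      (∀ u, powerSum (frobDeriv (-l - 1) (frobDeriv (-l) q)) u =
        (((l * (l + 1) : ℝ) : ℂ) - 4 * u) * powerSum q u + 2 * κ * u ^ n *
          powerSum (fun j => (2 * l + 1 + 4 * j) * besselCoeff (l + 1 / 2) j) u) ∧
      ∀ z t, 0 < t → theta l z t =
        (B : ℂ) * singularSol l κ n (besselCoeff (l + 1 / 2)) q z t := by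
  by_cases h : (⌊l + 1 / 2⌋₊ : ℝ) = l + 1 / 2
  · refine ⟨1, _, ⌊l + 1 / 2⌋₊, neumannCoeff ⌊l + 1 / 2⌋₊, entireCoeff_neumannCoeff _, Or.inr h,
      Or.inr ?_, fun u => ?_, fun z t ht => theta_eq_of_natCast h z ht⟩
    · rcases Nat.eq_zero_or_pos ⌊l + 1 / 2⌋₊ with h0 | h0
      · right
        rw [h0] at h
        norm_num at h
        linarith
      · exact Or.inl h0
    · rw [neumannCoeff_ode h u, h]
  · refine ⟨0, Real.sqrt Real.pi * 2 ^ l / Real.sin ((l + 1 / 2) * Real.pi), 0,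
      besselCoeff (-l - 1 / 2), entireCoeff_besselCoeff _, Or.inl rfl, Or.inl rfl,
      fun u => ?_, fun z t ht => ?_⟩
    · rw [besselCoeff_ode rfl, show -l * (-l - 1) = l * (l + 1) by ring]
      simp
    · rw [theta_eq_of_not_natCast hl h z ht, singularSol]
      simp

/-! ### Derivative bounds for the two functions -/

lemma hasDerivAt_frob_besselCoeff (l : ℝ) (z : ℂ) {t : ℝ} (ht : 0 < t) :
    HasDerivAt (frob (l + 1 - 1) (frobDeriv (l + 1) (besselCoeff (l + 1 / 2))) z)
      (((l * (l + 1) / t ^ 2 : ℝ) - z) * frob (l + 1) (besselCoeff (l + 1 / 2)) z t) t := by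
  refine (hasDerivAt_frob ((entireCoeff_besselCoeff _).frobDeriv _) _ z ht).congr_deriv ?_
  rw [frob_ode (m := l * (l + 1)) (R := fun _ => 0) (by simpa using besselCoeff_ode_regular l) z ht]
  simp

theorem exists_deriv_phi_bound (l : ℝ) : ∃ C : ℝ, 0 < C ∧ ∀ (z : ℂ) (x : ℝ), 0 < x →
    DifferentiableAt ℝ (fun t : ℝ => phi l z t) x ∧
    ‖deriv (fun t : ℝ => phi l z t) x‖ ≤ C * (x / (1 + Real.sqrt ‖z‖ * x)) ^ l *
      Real.exp (|(z ^ (1 / 2 : ℂ)).im| * x) := by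
  have hp := entireCoeff_besselCoeff (l + 1 / 2)
  set p := besselCoeff (l + 1 / 2)
  set K := ∑' j, ‖p j‖
  set K' := ∑' j, ‖frobDeriv (l + 1) p j‖
  have hK : 0 ≤ K := tsum_nonneg fun _ => norm_nonneg _
  have hK' : 0 ≤ K' := tsum_nonneg fun _ => norm_nonneg _
  obtain ⟨C, hC, h⟩ := exists_regular_bound (l := l) (C := K + K' + 1)
    (fun z t ht => hasDerivAt_frob hp (l + 1) z ht)
    (fun z t ht => hasDerivAt_frob_besselCoeff l z ht) (by positivity)
    (fun z t ht hst => (norm_frob_le (hp.frobDeriv _) _ ht hst).trans (by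
      rw [add_sub_cancel_right]
      gcongr
      linarith))
    (fun z t ht hst => (norm_frob_le hp _ ht hst).trans (by
      gcongr
      linarith))
  set A : ℝ := Real.sqrt Real.pi * (2 ^ (l + 1))⁻¹ with hA
  have hA0 : 0 < A := mul_pos (Real.sqrt_pos.2 Real.pi_pos) (by positivity)
  refine ⟨A * C, by positivity, fun z x hx => ?_⟩
  have hd : HasDerivAt (fun t : ℝ => phi l z t)
      ((A : ℂ) * frob (l + 1 - 1) (frobDeriv (l + 1) p) z x) x := by
    refine ((hasDerivAt_frob hp (l + 1) z hx).const_mul (A : ℂ)).congr_of_eventuallyEq ?_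
    filter_upwards [lt_mem_nhds hx] with t ht using phi_eq_frob l z ht
  refine ⟨hd.differentiableAt, ?_⟩
  rw [hd.deriv, norm_mul, Complex.norm_real, Real.norm_of_nonneg hA0.le, mul_assoc A, mul_assoc A]
  exact mul_le_mul_of_nonneg_left (h z x hx) hA0.le

theorem exists_deriv_green_bound {l ε : ℝ} (hl : -1 / 2 ≤ l) (hε : 0 ≤ ε)
    (hlε : l = -1 / 2 → ε = 1) :
    ∃ C : ℝ, 0 < C ∧ ∀ (z : ℂ) (x y : ℝ), 0 < y → y ≤ x → x < 1 →
      DifferentiableAt ℝ (fun t : ℝ => green l z t y) x ∧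
      ‖deriv (fun t : ℝ => green l z t y) x‖ ≤
        C * (x / (1 + Real.sqrt ‖z‖ * x)) ^ l * ((1 + Real.sqrt ‖z‖ * y) / y) ^ l *
          Real.exp (|(z ^ (1 / 2 : ℂ)).im| * (x - y)) * (1 - ε * Real.log y) := by
  obtain ⟨κ, B, n, q, hq, hn, hκ, hqE, hθ⟩ := exists_theta_eq_singularSol hl
  have hp := entireCoeff_besselCoeff (l + 1 / 2)
  obtain ⟨C₀, hC₀, h₀⟩ := exists_green_bound_near_zero hp hq hl hn hε
    (hκ.imp_right (Or.imp_right hlε))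
  obtain ⟨C, hC, h⟩ := exists_green_bound hε
    (fun z t ht => hasDerivAt_frob hp (l + 1) z ht)
    (fun z t ht => hasDerivAt_frob_besselCoeff l z ht)
    (fun z t ht => hasDerivAt_singularSol (l := l) (κ := κ) (n := n) hp hq z ht)
    (fun z t ht => hasDerivAt_singularSolDeriv hp hq hn (besselCoeff_ode_regular l) hqE z ht) hC₀
    (fun z x y hy hyx hs => (h₀ z x y hy hyx hs).1)
    (fun z x y hy hyx hs => (h₀ z x y hy hyx hs).2)
  set p := besselCoeff (l + 1 / 2)
  set A : ℝ := Real.sqrt Real.pi * (2 ^ (l + 1))⁻¹ with hA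
  -- Adding `1` gives a positive constant without showing `B ≠ 0`.
  refine ⟨(|A * B| + 1) * C, by positivity, fun z x y hy hyx hx1 => ?_⟩
  have hx : 0 < x := hy.trans_le hyx
  have hd : HasDerivAt (fun t : ℝ => green l z t y) (((A * B : ℝ) : ℂ) *
      (frob (l + 1 - 1) (frobDeriv (l + 1) p) z x * singularSol l κ n p q z y
        - frob (l + 1) p z y * singularSolDeriv l κ n p q z x)) x := by
    have h1 := ((hasDerivAt_frob hp (l + 1) z hx).mul_const (singularSol l κ n p q z y)).sub
      ((hasDerivAt_singularSol (l := l) (κ := κ) (n := n) hp hq z hx).const_mul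
        (frob (l + 1) p z y))
    refine (h1.const_mul ((A * B : ℝ) : ℂ)).congr_of_eventuallyEq ?_
    filter_upwards [lt_mem_nhds hx] with t ht
    rw [green, phi_eq_frob l z ht, phi_eq_frob l z hy, hθ z t ht, hθ z y hy]
    simp only [Pi.sub_apply, Complex.ofReal_mul]
    simp only [hA, Complex.ofReal_mul]
    ring
  refine ⟨hd.differentiableAt, ?_⟩
  rw [hd.deriv, norm_mul, Complex.norm_real, Real.norm_eq_abs]
  calc _ ≤ (|A * B| + 1) * _ :=
        mul_le_mul (by linarith) (h z x y hy hyx hx1) (norm_nonneg _) (by positivity)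
    _ = _ := by ring

lemma sqrt_ratio_eq {s x y : ℝ} (hs : 0 ≤ s) (hx : 0 < x) (hy : 0 < y) :
    (x / (1 + s * x)) ^ (-1 / 2 : ℝ) * ((1 + s * y) / y) ^ (-1 / 2 : ℝ) =
      Real.sqrt ((y + s * x * y) / (x + s * x * y)) := by
  rw [← Real.mul_rpow (by positivity) (by positivity), neg_div, Real.rpow_neg (by positivity),
    ← Real.inv_rpow (by positivity), Real.sqrt_eq_rpow]
  congr 1
  have h1 : 1 + s * x ≠ 0 := by positivity
  have h2 : 1 + s * y ≠ 0 := by positivity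
  have h3 : x + s * x * y = x * (1 + s * y) := by ring
  rw [h3]
  field_simp

end SphericalSchrodinger

end

theorem mainTheorem7 :
    -- the bound on the derivative of `φ_l`, for all `l ≥ -1/2`
    (∀ l : ℝ, -1 / 2 ≤ l → ∃ C : ℝ, 0 < C ∧ ∀ (z : ℂ) (x : ℝ), 0 < x → x < 1 →
      DifferentiableAt ℝ (fun t : ℝ => SphericalSchrodinger.phi l z t) x ∧
      ‖deriv (fun t : ℝ => SphericalSchrodinger.phi l z t) x‖ ≤
        C * (x / (1 + Real.sqrt ‖z‖ * x)) ^ l *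
          Real.exp (|(z ^ (1 / 2 : ℂ)).im| * x)) ∧
    -- the bound on the derivative of `G_l`, for `l > -1/2`
    (∀ l : ℝ, -1 / 2 < l → ∃ C : ℝ, 0 < C ∧ ∀ (z : ℂ) (x y : ℝ), 0 < y → y ≤ x → x < 1 →
      DifferentiableAt ℝ (fun t : ℝ => SphericalSchrodinger.green l z t y) x ∧
      ‖deriv (fun t : ℝ => SphericalSchrodinger.green l z t y) x‖ ≤
        C * (x / (1 + Real.sqrt ‖z‖ * x)) ^ l * ((1 + Real.sqrt ‖z‖ * y) / y) ^ l *
          Real.exp (|(z ^ (1 / 2 : ℂ)).im| * (x - y))) ∧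
    -- the bound on the derivative of `G_l`, for `l = -1/2`
    (∃ C : ℝ, 0 < C ∧ ∀ (z : ℂ) (x y : ℝ), 0 < y → y ≤ x → x < 1 →
      DifferentiableAt ℝ (fun t : ℝ => SphericalSchrodinger.green (-1 / 2) z t y) x ∧
      ‖deriv (fun t : ℝ => SphericalSchrodinger.green (-1 / 2) z t y) x‖ ≤
        C * Real.sqrt ((y + Real.sqrt ‖z‖ * x * y) / (x + Real.sqrt ‖z‖ * x * y)) *
          Real.exp (|(z ^ (1 / 2 : ℂ)).im| * (x - y)) * (1 - Real.log y)) := by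
  refine ⟨fun l _ => ?_, fun l hl => ?_, ?_⟩
  · obtain ⟨C, hC, h⟩ := SphericalSchrodinger.exists_deriv_phi_bound l
    exact ⟨C, hC, fun z x hx _ => h z x hx⟩
  -- The choice `ε = 0` removes the logarithmic weight, which is permitted as `l ≠ -1/2`.
  · obtain ⟨C, hC, h⟩ := SphericalSchrodinger.exists_deriv_green_bound (ε := 0) hl.le le_rfl
      fun h => absurd h hl.ne'
    refine ⟨C, hC, fun z x y hy hyx hx1 => ?_⟩
    simpa using h z x y hy hyx hx1
  · obtain ⟨C, hC, h⟩ := SphericalSchrodinger.exists_deriv_green_bound (ε := 1)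
      (le_refl (-1 / 2 : ℝ)) zero_le_one fun _ => rfl
    refine ⟨C, hC, fun z x y hy hyx hx1 => ?_⟩
    obtain ⟨h1, h2⟩ := h z x y hy hyx hx1
    rw [mul_assoc C, SphericalSchrodinger.sqrt_ratio_eq (Real.sqrt_nonneg _) (hy.trans_le hyx) hy,
      one_mul] at h2
    exact ⟨h1, h2⟩
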